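/- **Theorem 3.1.** Let $\mu,\nu$ be Borel probability measures on $(0,\infty)$. On $\Omega=(0,\infty)^{\mathbb N}\times(0,\infty)^{\mathbb N}$ with its Borel $\sigma$-algebra $\Sigma$ let $W_1,W_2,\dots$ (interarrival times) and $X_1,X_2,\dots$ (claim sizes) be the coordinate maps, and let $P=\mu^{\otimes\mathbb N}\otimes\nu^{\otimes\mathbb N}$. Put $T_n=\sum_{k\le n}W_k$ (with $T_0=0$), and for $t\ge 0$ put $N_t=\#\{n\ge1:T_n\le t\}$, $S_t=\sum_{j\le N_t}X_j$, $J_t=t-T_{N_t}$ and $V_t=T_{N_t+1}-t$. Let $\mathcal F_t=\sigma(S_s:s\le t)$ and $\mathcal H_t=\sigma(S_s,V_s:s\le t)$. Let $c>0$ and assume $E_P[X_1]<\infty$, $E_P[W_1]<\infty$ and the net profit condition $c\,E_P[W_1]>E_P[X_1]$. For $u\ge0$ let $R^u_t=u+ct-S_t$, $\tau_u=\inf\{t\ge0:R^u_t<0\}$ (with $\inf\varnothing=\infty$) and $\psi(u)=P(\inf_{t\ge 0}R^u_t<0)$. Fix $v\ge0$. Let $\mathcal R_S$ be the class of probability measures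 $Q$ on $\Sigma$ such that: under $Q$ the $W_n$ are i.i.d., the $X_n$ are i.i.d., and the sequence $(X_n)$ is independent of the process $(N_t)$; for every $t\ge 0$, $Q$ and $P$ have the same null sets in $\mathcal H_t$; $E_Q[X_1]<\infty$ and $E_Q[W_1]<\infty$; and $Q(\tau_v<\infty)=1$. Let $\mathcal C_P$ be the class of pairs $(\gamma,\delta)$ of real-valued Borel functions on $(0,\infty)$ with $E_P[e^{\gamma(X_1)}]=E_P[e^{\delta(W_1)}]=1$, $E_P[X_1e^{\gamma(X_1)}]<\infty$, $E_P[W_1e^{\delta(W_1)}]<\infty$ and $c\,E_P[W_1e^{\delta(W_1)}]\le E_P[X_1e^{\gamma(X_1)}]$. Two pairs $(\gamma,\delta)$, $(\gamma',\delta')$ are called essentially equal if $\gamma=\gamma'$ $P_{X_1}$-a.s. and $\delta=\delta'$ $P_{W_1}$-a.s. For a pair $(\gamma,\delta)$ put $$L_t=\exp\Big(\sum_{j=1}^{N_t}\gamma(X_j)+\sum_{j=1}^{N_t+1}\delta(W_j)\Big),\qquad M_t=\exp\Big(\sum_{j=1}^{N_t}\gamma(X_j)+\sum_{j=1}^{N_t}\delta(W_j)\Big)\cdot\frac{\int_{(J_t,\infty)}e^{\delta(w)}\,P_{W_1}(dw)}{P_{W_1}((J_t,\infty))}.$$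 No moment generating function is assumed to exist. The following hold. (i) For every $Q\in\mathcal R_S$ there is a pair $(\gamma,\delta)\in\mathcal C_P$, unique up to essential equality, such that for all $t\ge0$ the density of $Q$ with respect to $P$ is $L_t$ on $\mathcal H_t$ and $M_t$ on $\mathcal F_t$ (a.s. with respect to the corresponding restriction of $P$). Moreover $$\psi(u)=E_Q\Big[\exp\Big(-\sum_{j=1}^{N_{\tau_u}}\gamma(X_j)-\sum_{j=1}^{N_{\tau_u}}\delta(W_j)\Big)\Big]\quad\text{for all }u\ge0.\qquad(\ast)$$ (ii) Conversely, for every $(\gamma,\delta)\in\mathcal C_P$ there is exactly one probability measure $Q$ on $\Sigma$ with $Q(A)=E_P[\mathbf 1_A L_t]$ for all $t\ge0$ and $A\in\mathcal H_t$; it belongs to $\mathcal R_S$, its density with respect to $P$ on $\mathcal F_t$ is $M_t$ for every $t\ge0$, and $(\ast)$ holds. (iii) The relation "$Q(A)=E_P[\mathbf 1_A L_t]$ for all $t\ge0$ and $A\in\mathcal H_t$" is a one-to-one correspondence between $\mathcal R_S$ and $\mathcal C_P$ modulo essential equality. -/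

import Mathlib

open MeasureTheory ProbabilityTheory
open scoped NNReal ENNReal

namespace SparreAndersen

noncomputable section

/-- The open half-line `(0,∞)`, with its Borel σ-algebra. -/
abbrev PosReal : Type := Set.Ioi (0 : ℝ)

/-- The canonical space `(0,∞)^ℕ × (0,∞)^ℕ` of interarrival times and claim sizes, with its
product (equivalently, Borel) σ-algebra. -/
abbrev Ω : Type := (ℕ → PosReal) × (ℕ → PosReal)

/-- The `(n+1)`-st interarrival time: sequences are indexed from `0` here. -/
def W (n : ℕ) (ω : Ω) : PosReal := ω.1 n

/-- The `(n+1)`-st claim size. -/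
def X (n : ℕ) (ω : Ω) : PosReal := ω.2 n

/-- The measure under which all `W n` have law `μ`, all `X n` have law `ν`, and all are
independent. -/
def canonical (μ ν : Measure PosReal) [IsProbabilityMeasure μ] [IsProbabilityMeasure ν] :
    Measure Ω :=
  (Measure.infinitePi fun _ : ℕ => μ).prod (Measure.infinitePi fun _ : ℕ => ν)

/-- Arrival times: `T n` is the time of the `n`-th claim, and `T 0 = 0`. -/
def T (n : ℕ) (ω : Ω) : ℝ := ∑ k ∈ Finset.range n, (W k ω : ℝ)

/-- The number of `n ≥ 1` with `T n ≤ t`. If there are infinitely many (an event of probability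
zero under every measure for which the interarrival times are i.i.d.) the value is `0`. -/
def N (t : ℝ≥0) (ω : Ω) : ℕ := {n : ℕ | T (n + 1) ω ≤ t}.ncard

/-- Aggregate claims. -/
def S (t : ℝ≥0) (ω : Ω) : ℝ := ∑ j ∈ Finset.range (N t ω), (X j ω : ℝ)

/-- Backward recurrence time. -/
def J (t : ℝ≥0) (ω : Ω) : ℝ := t - T (N t ω) ω

/-- Forward recurrence time. -/
def V (t : ℝ≥0) (ω : Ω) : ℝ := T (N t ω + 1) ω - t

/-! ### Measurability, needed in order to speak of the natural filtrations -/

theorem measurable_W (n : ℕ) : Measurable (W n) := by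
  unfold W; fun_prop

theorem measurable_X (n : ℕ) : Measurable (X n) := by
  unfold X; fun_prop

theorem measurable_T (n : ℕ) : Measurable (T n) := by
  unfold T
  exact Finset.measurable_sum _ fun k _ => measurable_subtype_coe.comp (measurable_W k)

theorem T_strictMono (ω : Ω) : StrictMono fun n => T n ω := by
  refine strictMono_nat_of_lt_succ fun n => ?_
  have h : (0 : ℝ) < W n ω := (W n ω).2
  simp only [T, Finset.sum_range_succ]
  linarith

theorem N_eq_succ_iff (t : ℝ≥0) (ω : Ω) (n : ℕ) :
    N t ω = n + 1 ↔ T (n + 1) ω ≤ t ∧ (t : ℝ) < T (n + 2) ω := by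
  have hmono := (T_strictMono ω).monotone
  have key : T (n + 1) ω ≤ t → (t : ℝ) < T (n + 2) ω → N t ω = n + 1 := by
    intro h1 h2
    have : {k : ℕ | T (k + 1) ω ≤ t} = (Finset.range (n + 1) : Set ℕ) := by
      ext k
      simp only [Set.mem_ofPred_eq, Finset.coe_range, Set.mem_Iio]
      constructor
      · intro hk
        by_contra hlt
        have : T (n + 2) ω ≤ T (k + 1) ω := hmono (by omega)
        linarith
      · intro hk
        have : T (k + 1) ω ≤ T (n + 1) ω := hmono (by omega)
        linarith
    unfold N
    rw [this, Set.ncard_coe_finset, Finset.card_range]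
  constructor
  · intro h
    have hfin : {k : ℕ | T (k + 1) ω ≤ t}.Finite :=
      Set.finite_of_ncard_pos (by unfold N at h; omega)
    obtain ⟨m, hm⟩ : ∃ m, (t : ℝ) < T (m + 1) ω := by
      by_contra hcon
      push Not at hcon
      exact Set.infinite_univ (hfin.subset fun k _ => hcon k)
    classical
    have hm' := Nat.find_spec (⟨m, hm⟩ : ∃ m, (t : ℝ) < T (m + 1) ω)
    have hmin := fun k => Nat.find_min (⟨m, hm⟩ : ∃ m, (t : ℝ) < T (m + 1) ω) (m := k)
    generalize Nat.find (⟨m, hm⟩ : ∃ m, (t : ℝ) < T (m + 1) ω) = q at hm' hmin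
    rcases q with _ | q
    · have : {k : ℕ | T (k + 1) ω ≤ t} = ∅ := by
        ext k
        simp only [Set.mem_ofPred_eq, Set.mem_empty_iff_false, iff_false, not_le]
        exact hm'.trans_le (hmono (by omega))
      unfold N at h
      rw [this] at h
      simp at h
    · -- the first `q + 1` arrivals are the ones up to time `t`
      have h1 : T (q + 1) ω ≤ t := not_lt.mp (hmin q (by omega))
      have hN : N t ω = q + 1 := by
        have : {k : ℕ | T (k + 1) ω ≤ t} = (Finset.range (q + 1) : Set ℕ) := by
          ext k
          simp only [Set.mem_ofPred_eq, Finset.coe_range, Set.mem_Iio]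
          constructor
          · intro hk
            by_contra hlt
            have : T (q + 1 + 1) ω ≤ T (k + 1) ω := hmono (by omega)
            linarith
          · intro hk
            have : T (k + 1) ω ≤ T (q + 1) ω := hmono (by omega)
            linarith
        unfold N
        rw [this, Set.ncard_coe_finset, Finset.card_range]
      obtain rfl : q = n := by omega
      exact ⟨h1, hm'⟩
  · rintro ⟨h1, h2⟩
    exact key h1 h2

theorem measurable_N (t : ℝ≥0) : Measurable (N t) := by
  have hsucc : ∀ n : ℕ, MeasurableSet (N t ⁻¹' {n + 1}) := by
    intro n
    have : N t ⁻¹' {n + 1} = {ω | T (n + 1) ω ≤ t} ∩ {ω | (t : ℝ) < T (n + 2) ω} := by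
      ext ω
      simp [N_eq_succ_iff]
    rw [this]
    exact (measurableSet_le (measurable_T _) measurable_const).inter
      (measurableSet_lt measurable_const (measurable_T _))
  refine measurable_to_countable' fun n => ?_
  rcases n with _ | n
  · have : N t ⁻¹' {0} = (⋃ n : ℕ, N t ⁻¹' {n + 1})ᶜ := by
      ext ω
      simp only [Set.mem_preimage, Set.mem_singleton_iff, Set.mem_compl_iff, Set.mem_iUnion,
        not_exists]
      constructor
      · intro h n; omega
      · intro h
        rcases hN : N t ω with _ | k
        · rfl
        · exact absurd hN (h k)
    rw [this]
    exact (MeasurableSet.iUnion hsucc).compl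
  · exact hsucc n

theorem measurable_S (t : ℝ≥0) : Measurable (S t) := by
  have h : Measurable fun p : ℕ × Ω => ∑ j ∈ Finset.range p.1, (X j p.2 : ℝ) :=
    measurable_from_prod_countable_right fun n =>
      Finset.measurable_sum (Finset.range n) fun j _ =>
        measurable_subtype_coe.comp (measurable_X j)
  exact h.comp ((measurable_N t).prodMk measurable_id)

theorem measurable_V (t : ℝ≥0) : Measurable (V t) := by
  have h : Measurable fun p : ℕ × Ω => T (p.1 + 1) p.2 - (t : ℝ) :=
    measurable_from_prod_countable_right fun n => (measurable_T (n + 1)).sub_const _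
  exact h.comp ((measurable_N t).prodMk measurable_id)

/-! ### Filtrations -/

/-- The natural filtration of the aggregate claims process. -/
def filtF : Filtration ℝ≥0 (inferInstance : MeasurableSpace Ω) :=
  Filtration.natural S fun t => (measurable_S t).stronglyMeasurable

/-- The natural filtration of the forward recurrence time. -/
def filtV : Filtration ℝ≥0 (inferInstance : MeasurableSpace Ω) :=
  Filtration.natural V fun t => (measurable_V t).stronglyMeasurable

/-- The filtration generated by the aggregate claims and the forward recurrence time. -/
def filtH : Filtration ℝ≥0 (inferInstance : MeasurableSpace Ω) := filtF ⊔ filtV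

/-! ### Surplus, ruin time, ruin probability -/

/-- Surplus at time `t` with initial capital `u` and premium rate `c`. -/
def surplus (c : ℝ) (u t : ℝ≥0) (ω : Ω) : ℝ := u + c * t - S t ω

/-- The ruin time, with `inf ∅ = ∞`. -/
def ruinTime (c : ℝ) (u : ℝ≥0) (ω : Ω) : ℝ≥0∞ :=
  ⨅ (t : ℝ≥0) (_ : surplus c u t ω < 0), (t : ℝ≥0∞)

/-- The infinite-time ruin probability. The infimum over time is taken in the extended reals. -/
def ruinProb (P : Measure Ω) (c : ℝ) (u : ℝ≥0) : ℝ≥0∞ :=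
  P {ω | (⨅ t : ℝ≥0, (surplus c u t ω : EReal)) < 0}

/-! ### Classes of measures and of tilting functions -/

/-- Expectation, in `[0,∞]`, of a nonnegative function. -/
def expect (P : Measure Ω) (f : Ω → ℝ) : ℝ≥0∞ := ∫⁻ ω, ENNReal.ofReal (f ω) ∂P

/-- The aggregate claims process is a compound renewal process under `Q`: interarrival times are
i.i.d., claim sizes are i.i.d., and the claim size sequence is independent of the counting
process. -/
structure IsCompoundRenewal (Q : Measure Ω) : Prop where
  indep_W : iIndepFun W Q
  ident_W : ∀ n, IdentDistrib (W n) (W 0) Q Q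
  indep_X : iIndepFun X Q
  ident_X : ∀ n, IdentDistrib (X n) (X 0) Q Q
  indep_XN : IndepFun (fun ω n => X n ω) (fun ω t => N t ω) Q

/-- `Q` is a probability measure under which the aggregate claims process is a compound renewal
process, it is equivalent to `P` on each `filtH t`, and the mean claim size and mean interarrival
time under `Q` are finite. -/
structure MemMS1 (P Q : Measure Ω) : Prop where
  isProb : IsProbabilityMeasure Q
  crp : IsCompoundRenewal Q
  progEquiv : ∀ (t : ℝ≥0) (A : Set Ω), MeasurableSet[filtH t] A → (Q A = 0 ↔ P A = 0)
  mean_X : expect Q (fun ω => X 0 ω) < ∞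
  mean_W : expect Q (fun ω => W 0 ω) < ∞

/-- Ruin-inducing measures: those under which, in addition, ruin from initial capital `u` is almost
sure. -/
structure RuinInducing (P : Measure Ω) (c : ℝ) (u : ℝ≥0) (Q : Measure Ω) : Prop where
  memMS1 : MemMS1 P Q
  ruin : Q {ω | ruinTime c u ω < ∞} = 1

/-- Pairs `(γ, δ)` of measurable functions on `(0,∞)` with `E_P[e^{γ(X₁)}] = E_P[e^{δ(W₁)}] = 1`,
finite tilted means, and `c E_P[W₁ e^{δ(W₁)}] ≤ E_P[X₁ e^{γ(X₁)}]`. -/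
structure MemCP (P : Measure Ω) (c : ℝ) (γ δ : PosReal → ℝ) : Prop where
  meas_γ : Measurable γ
  meas_δ : Measurable δ
  norm_γ : expect P (fun ω => Real.exp (γ (X 0 ω))) = 1
  norm_δ : expect P (fun ω => Real.exp (δ (W 0 ω))) = 1
  mean_γ : expect P (fun ω => X 0 ω * Real.exp (γ (X 0 ω))) < ∞
  mean_δ : expect P (fun ω => W 0 ω * Real.exp (δ (W 0 ω))) < ∞
  drift : ENNReal.ofReal c * expect P (fun ω => W 0 ω * Real.exp (δ (W 0 ω)))
    ≤ expect P (fun ω => X 0 ω * Real.exp (γ (X 0 ω)))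

/-- Essential equality of pairs: `γ = γ'` a.s. for the law of `X₁` and `δ = δ'` a.s. for the law of
`W₁` under `P`. -/
def EssEq (P : Measure Ω) (γ δ γ' δ' : PosReal → ℝ) : Prop :=
  γ =ᵐ[P.map (X 0)] γ' ∧ δ =ᵐ[P.map (W 0)] δ'

/-- The relation of essential equality on the admissible pairs. -/
def pairSetoid (P : Measure Ω) (c : ℝ) :
    Setoid {p : (PosReal → ℝ) × (PosReal → ℝ) // MemCP P c p.1 p.2} where
  r p q := EssEq P p.1.1 p.1.2 q.1.1 q.1.2
  iseqv :=
    { refl := fun _ => ⟨ae_eq_refl _, ae_eq_refl _⟩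
      symm := fun h => ⟨h.1.symm, h.2.symm⟩
      trans := fun h k => ⟨h.1.trans k.1, h.2.trans k.2⟩ }

/-! ### Likelihood ratios -/

/-- `∑ γ(X_j)` over the first `n` claims. -/
def sumγ (γ : PosReal → ℝ) (n : ℕ) (ω : Ω) : ℝ := ∑ j ∈ Finset.range n, γ (X j ω)

/-- `∑ δ(W_j)` over the first `n` interarrival times. -/
def sumδ (δ : PosReal → ℝ) (n : ℕ) (ω : Ω) : ℝ := ∑ j ∈ Finset.range n, δ (W j ω)

/-- `L_t = exp(∑_{j ≤ N_t} γ(X_j) + ∑_{j ≤ N_t + 1} δ(W_j))`. -/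
def likeL (γ δ : PosReal → ℝ) (t : ℝ≥0) (ω : Ω) : ℝ≥0∞ :=
  ENNReal.ofReal (Real.exp (sumγ γ (N t ω) ω + sumδ δ (N t ω + 1) ω))

/-- `M_t = exp(∑_{j ≤ N_t} γ(X_j) + ∑_{j ≤ N_t} δ(W_j))` times
`(∫_{(J_t,∞)} e^δ dP_{W₁}) / P_{W₁}(J_t,∞)`. -/
def likeM (P : Measure Ω) (γ δ : PosReal → ℝ) (t : ℝ≥0) (ω : Ω) : ℝ≥0∞ :=
  ENNReal.ofReal (Real.exp (sumγ γ (N t ω) ω + sumδ δ (N t ω) ω)) *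
    ((∫⁻ w in {w : PosReal | J t ω < w}, ENNReal.ofReal (Real.exp (δ w)) ∂(P.map (W 0))) /
      (P.map (W 0)) {w : PosReal | J t ω < w})

/-- On each `filtH t`, the density of `Q` with respect to `P` is `L_t`. -/
def DensityH (P Q : Measure Ω) (γ δ : PosReal → ℝ) : Prop :=
  ∀ t : ℝ≥0, (Q.trim (filtH.le t)).rnDeriv (P.trim (filtH.le t))
    =ᵐ[P.trim (filtH.le t)] likeL γ δ t

/-- On each `filtF t`, the density of `Q` with respect to `P` is `M_t`. -/
def DensityF (P Q : Measure Ω) (γ δ : PosReal → ℝ) : Prop :=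
  ∀ t : ℝ≥0, (Q.trim (filtF.le t)).rnDeriv (P.trim (filtF.le t))
    =ᵐ[P.trim (filtF.le t)] likeM P γ δ t

/-- `Q(A) = E_P[1_A L_t]` for all `t` and all `A ∈ filtH t`. -/
def DeterminedBy (P Q : Measure Ω) (γ δ : PosReal → ℝ) : Prop :=
  ∀ (t : ℝ≥0) (A : Set Ω), MeasurableSet[filtH t] A → Q A = ∫⁻ ω in A, likeL γ δ t ω ∂P

/-- The representation
`ψ(u) = E_Q[exp(-∑_{j ≤ N_τ} γ(X_j) - ∑_{j ≤ N_τ} δ(W_j))]`, `τ` the ruin time from capital `u`,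
for all `u ≥ 0`. -/
def RuinRepresentation (P : Measure Ω) (c : ℝ) (Q : Measure Ω) (γ δ : PosReal → ℝ) : Prop :=
  ∀ u : ℝ≥0, ruinProb P c u = expect Q fun ω =>
    Real.exp (-sumγ γ (N (ruinTime c u ω).toNNReal ω) ω
      - sumδ δ (N (ruinTime c u ω).toNNReal ω) ω)

end

end SparreAndersen

open SparreAndersen

namespace SparreAndersen

noncomputable section

/-! ### Generalities on product measures and on measurability -/

/-! The measures in the class are exactly the canonical product measures whose marginals are tilted
by `exp ∘ δ` and `exp ∘ γ` for an admissible pair. The arrival times can be read off the counting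
process, so independence of claims and counting process amounts to independence of the two
sequences, and `Q` is the product of its marginals (`IsCompoundRenewal.eq_canonical`). The marginals
are equivalent to those of `P` because the first interarrival time is the forward recurrence time at
time 0, and the first claim is visible once a claim has arrived (`MemMS1.exists_map_eq_tilt`). The
logarithms of the marginal densities are `δ` and `γ`.

On the event that exactly `n` claims arrive up to `t`, a set of `filtH t` involves only `n` claims
and `n + 1` interarrival times, so the density there is the finite product `likeL`
(`determinedBy_canonical_tilt`). A set of `filtF t` knows of the last of these interarrival times
only that it exceeds the backward recurrence time; integrating it out turns `likeL` into `likeM`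
(`setLIntegral_likeL_eq_likeM`). Measurability with respect to the filtrations rests on Blackwell's
principle (`measurableSet_comap_of_saturated`): a Borel set that depends only on countably many
observations belongs to the σ-algebra they generate. As the `filtF t` together generate everything,
`likeL` determines `Q`.

Ruin can only happen at claim arrivals, so it concerns the random walk with steps `c W - X`. Almost
sure ruin excludes positive drift (`mean_nonpos_of_ae_exists_walk_neg`). Conversely, a nondegenerate
walk with nonpositive drift is unbounded below (`ae_exists_walk_lt`); the net profit condition
supplies the nondegeneracy, which matters when the drift is zero. The ruin formula follows by
summing over the index of the claim that causes ruin: that event involves as many interarrival times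
as claims, and it exhausts the space under `Q`. -/

/-- A measurable set that is a union of fibres of a measurable map from a standard Borel space
belongs to the σ-algebra generated by that map. -/
theorem measurableSet_comap_of_saturated {α β : Type*} [MeasurableSpace α] [StandardBorelSpace α]
    [mβ : MeasurableSpace β] [MeasurableSpace.CountablySeparated β] {f : α → β} (hf : Measurable f)
    {A : Set α} (hA : MeasurableSet A) (hsat : ∀ x y, f x = f y → x ∈ A → y ∈ A) :
    MeasurableSet[MeasurableSpace.comap f mβ] A := by
  have hpre : f ⁻¹' (f '' A) = A := by
    ext y
    constructor
    · rintro ⟨x, hx, hxy⟩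
      exact hsat x y hxy hx
    · intro hy
      exact ⟨y, hy, rfl⟩
  have : MeasurableSpace.CountablySeparated (Set.range f) :=
    MeasurableSpace.Subtype.countablySeparated
  -- Lusin separation: the images of `A` and of its complement are disjoint analytic sets, hence
  -- Borel in the range of `f`.
  have h : MeasurableSet (((↑) : Set.range f → β) ⁻¹' (f '' A)) := by
    rw [← hf.measurableSet_preimage_iff_preimage_val, hpre]
    exact hA
  obtain ⟨s, hs, hs'⟩ := h
  refine ⟨s, hs, ?_⟩
  ext y
  have := Set.ext_iff.1 hs' ⟨f y, y, rfl⟩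
  simp only [Set.mem_preimage] at this
  rw [Set.mem_preimage, this, ← Set.mem_preimage, hpre]

section InfinitePi

variable {α : Type*} [MeasurableSpace α] (μ : Measure α) [IsProbabilityMeasure μ]

theorem lintegral_prod_infinitePi (s : Finset ℕ) (g : ℕ → α → ℝ≥0∞) (hg : ∀ i, Measurable (g i)) :
    ∫⁻ w, ∏ i ∈ s, g i (w i) ∂(Measure.infinitePi fun _ : ℕ => μ) = ∏ i ∈ s, ∫⁻ a, g i a ∂μ := by
  have hind := iIndepFun_infinitePi (P := fun _ : ℕ => μ) hg
  refine (lintegral_prod_eq_prod_lintegral_of_indepFun s (fun i (w : ℕ → α) => g i (w i)) hind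
    (fun i => (hg i).comp (measurable_pi_apply i))).trans ?_
  refine Finset.prod_congr rfl fun i _ => ?_
  have := (measurePreserving_eval_infinitePi (fun _ : ℕ => μ) i).lintegral_comp (hg i)
  simpa using this

/-- Resampling one coordinate does not change an infinite product measure. -/
theorem map_update_infinitePi (n : ℕ) :
    ((Measure.infinitePi fun _ : ℕ => μ).prod μ).map (fun p => Function.update p.1 n p.2)
      = Measure.infinitePi fun _ : ℕ => μ := by
  have hm : Measurable fun p : (ℕ → α) × α => Function.update p.1 n p.2 := by
    refine measurable_pi_lambda _ fun i => ?_
    by_cases h : i = n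
    · subst h; simpa using measurable_snd
    · simp only [Function.update_of_ne h]; fun_prop
  refine Measure.eq_infinitePi _ fun s t ht => ?_
  rw [Measure.map_apply hm (MeasurableSet.pi s.countable_toSet fun i _ => ht i)]
  by_cases hn : n ∈ s
  · have : (fun p : (ℕ → α) × α => Function.update p.1 n p.2) ⁻¹' (Set.pi s t)
        = (Set.pi (s.erase n : Finset ℕ) t) ×ˢ (t n) := by
      ext p
      simp only [Set.mem_preimage, Set.mem_pi, Set.mem_prod, Finset.mem_coe, Finset.mem_erase]
      constructor
      · intro h
        refine ⟨fun i hi => ?_, by simpa using h n hn⟩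
        simpa [Function.update_of_ne hi.1] using h i hi.2
      · rintro ⟨h1, h2⟩ i hi
        by_cases hin : i = n
        · subst hin; simpa using h2
        · simpa [Function.update_of_ne hin] using h1 i ⟨hin, hi⟩
    rw [this, Measure.prod_prod, Measure.infinitePi_pi _ fun i _ => ht i,
      Finset.prod_erase_mul _ _ hn]
  · have : (fun p : (ℕ → α) × α => Function.update p.1 n p.2) ⁻¹' (Set.pi s t)
        = (Set.pi s t) ×ˢ Set.univ := by
      ext p
      simp only [Set.mem_preimage, Set.mem_pi, Set.mem_prod, Finset.mem_coe, Set.mem_univ, and_true]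
      refine forall₂_congr fun i hi => ?_
      have hin : i ≠ n := fun h => hn (h ▸ hi)
      simp [Function.update_of_ne hin]
    rw [this, Measure.prod_prod, Measure.infinitePi_pi _ fun i _ => ht i]
    simp

theorem lintegral_update_infinitePi (n : ℕ) {f : (ℕ → α) → ℝ≥0∞} (hf : Measurable f) :
    ∫⁻ w, f w ∂(Measure.infinitePi fun _ : ℕ => μ)
      = ∫⁻ w, ∫⁻ a, f (Function.update w n a) ∂μ ∂(Measure.infinitePi fun _ : ℕ => μ) := by
  have hm : Measurable fun p : (ℕ → α) × α => Function.update p.1 n p.2 := by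
    refine measurable_pi_lambda _ fun i => ?_
    by_cases h : i = n
    · subst h; simpa using measurable_snd
    · simp only [Function.update_of_ne h]; fun_prop
  conv_lhs => rw [← map_update_infinitePi μ n, lintegral_map hf hm]
  exact lintegral_prod (fun p : (ℕ → α) × α => f (Function.update p.1 n p.2))
    (hf.comp hm).aemeasurable

/-- The first coordinate of an i.i.d. sequence is independent of the shifted sequence. -/
theorem map_zero_tail_infinitePi :
    (Measure.infinitePi fun _ : ℕ => μ).map (fun w => (w 0, fun i => w (i + 1)))
      = μ.prod (Measure.infinitePi fun _ : ℕ => μ) := by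
  have hcons : Measurable fun p : α × (ℕ → α) => (fun i => Nat.casesOn i p.1 p.2 : ℕ → α) := by
    refine measurable_pi_lambda _ fun i => ?_
    cases i with
    | zero => exact measurable_fst
    | succ i => exact (measurable_pi_apply i).comp measurable_snd
  have hm : Measurable fun w : ℕ → α => (w 0, fun i => w (i + 1)) := by fun_prop
  have key : (μ.prod (Measure.infinitePi fun _ : ℕ => μ)).map
      (fun p : α × (ℕ → α) => (fun i => Nat.casesOn i p.1 p.2 : ℕ → α))
      = Measure.infinitePi fun _ : ℕ => μ := by
    refine Measure.eq_infinitePi _ fun s t ht => ?_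
    rw [Measure.map_apply hcons (MeasurableSet.pi s.countable_toSet fun i _ => ht i)]
    have h1 : (Measure.infinitePi fun _ : ℕ => μ) (Set.pi s t) = ∏ i ∈ s, μ (t i) :=
      Measure.infinitePi_pi _ fun i _ => ht i
    -- Padding the box with full factors replaces `s` by an initial segment of indices, from which
    -- index 0 splits off.
    let t' : ℕ → Set α := fun i => if i ∈ s then t i else Set.univ
    have ht' : ∀ i, MeasurableSet (t' i) := fun i => by
      simp only [t']; split_ifs
      exacts [ht i, MeasurableSet.univ]
    obtain ⟨M, hM⟩ : ∃ M, ∀ i ∈ s, i < M + 1 :=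
      ⟨s.sup id, fun i hi => Nat.lt_succ_of_le (Finset.le_sup (f := id) hi)⟩
    have hpre : (fun p : α × (ℕ → α) => (fun i => Nat.casesOn i p.1 p.2 : ℕ → α)) ⁻¹' (Set.pi s t)
        = (t' 0) ×ˢ (Set.pi (Finset.range M) fun i => t' (i + 1)) := by
      ext p
      simp only [Set.mem_preimage, Set.mem_pi, Finset.mem_coe, Set.mem_prod, Finset.mem_range, t']
      constructor
      · intro h
        refine ⟨?_, fun i hi => ?_⟩
        · split_ifs with h0
          exacts [h 0 h0, trivial]
        · split_ifs with h0
          exacts [h (i + 1) h0, trivial]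
      · rintro ⟨h1, h2⟩ i hi
        cases i with
        | zero => simpa [hi] using h1
        | succ i => simpa [hi] using h2 i (by have := hM _ hi; omega)
    rw [hpre, Measure.prod_prod, Measure.infinitePi_pi _ fun i _ => ht' (i + 1), mul_comm,
      ← Finset.prod_range_succ' (fun i => μ (t' i))]
    have hs : s ⊆ Finset.range (M + 1) := fun i hi => Finset.mem_range.2 (hM i hi)
    rw [← Finset.prod_subset hs]
    · refine Finset.prod_congr rfl fun i hi => by simp [t', hi]
    · intro i _ hi
      simp [t', hi]
  conv_lhs => rw [← key]
  rw [Measure.map_map hm hcons]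
  exact Measure.map_id

/-- Tilting finitely many coordinates of an i.i.d. sequence. -/
theorem map_restrict_infinitePi_withDensity {f : α → ℝ≥0∞} (hf : Measurable f)
    [IsProbabilityMeasure (μ.withDensity f)] (m : ℕ) :
    (Measure.infinitePi fun _ : ℕ => μ.withDensity f).map (Finset.range m).restrict
      = ((Measure.infinitePi fun _ : ℕ => μ).withDensity
          fun w => ∏ i ∈ Finset.range m, f (w i)).map (Finset.range m).restrict := by
  rw [Measure.infinitePi_map_restrict]
  refine Measure.pi_eq fun s hs => ?_
  let s' : ℕ → Set α := fun i => if h : i ∈ Finset.range m then s ⟨i, h⟩ else Set.univ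
  have hs' : ∀ i, MeasurableSet (s' i) := fun i => by
    simp only [s']; split_ifs
    exacts [hs _, MeasurableSet.univ]
  have hpre : (Finset.range m).restrict ⁻¹' (Set.univ.pi s)
      = Set.pi (Finset.range m : Set ℕ) s' := by
    ext w
    simp only [Set.mem_preimage, Set.mem_pi, Set.mem_univ, true_imp_iff, s', Finset.mem_coe,
      Finset.restrict]
    constructor
    · intro h i hi
      rw [dif_pos hi]
      exact h ⟨i, hi⟩
    · rintro h ⟨i, hi⟩
      have := h i hi
      rwa [dif_pos hi] at this
  have hbox : MeasurableSet (Set.pi (Finset.range m : Set ℕ) s') :=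
    MeasurableSet.pi (Finset.countable_toSet _) fun i _ => hs' i
  rw [Measure.map_apply (by fun_prop) (MeasurableSet.univ_pi hs), hpre, withDensity_apply _ hbox,
    ← lintegral_indicator hbox]
  -- Density and box indicator both factor over the coordinates, so the integral becomes a product
  -- of one-dimensional ones.
  have hind : ∀ w : ℕ → α, (Set.pi (Finset.range m : Set ℕ) s').indicator
      (fun w => ∏ i ∈ Finset.range m, f (w i)) w
      = ∏ i ∈ Finset.range m, (s' i).indicator f (w i) := by
    intro w
    by_cases hw : w ∈ Set.pi (Finset.range m : Set ℕ) s'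
    · rw [Set.indicator_of_mem hw]
      exact Finset.prod_congr rfl fun i hi => (Set.indicator_of_mem (hw i hi) _).symm
    · rw [Set.indicator_of_notMem hw]
      simp only [Set.mem_pi, not_forall] at hw
      obtain ⟨i, hi, hiw⟩ := hw
      exact (Finset.prod_eq_zero hi (Set.indicator_of_notMem hiw _)).symm
  simp_rw [hind]
  rw [lintegral_prod_infinitePi μ (Finset.range m) (fun i => (s' i).indicator f)
    fun i => hf.indicator (hs' i), ← Finset.prod_coe_sort (Finset.range m)]
  refine Finset.prod_congr rfl fun i _ => ?_
  rw [withDensity_apply _ (hs i), lintegral_indicator (hs' _)]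
  simp only [s', Finset.coe_mem, dite_true]

end InfinitePi

/-! ### Random walks with integrable steps -/

section RandomWalk

open Filter Topology

/-- Partial sums of a real sequence. -/
def walk (n : ℕ) (x : ℕ → ℝ) : ℝ := ∑ i ∈ Finset.range n, x i

@[simp] theorem walk_zero (x : ℕ → ℝ) : walk 0 x = 0 := by simp [walk]

theorem walk_succ' (n : ℕ) (x : ℕ → ℝ) : walk (n + 1) x = x 0 + walk n fun i => x (i + 1) := by
  simp only [walk, Finset.sum_range_succ', add_comm]

theorem walk_add (n k : ℕ) (x : ℕ → ℝ) :
    walk (k + n) x = walk k x + walk n fun i => x (i + k) := by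
  rw [walk, Finset.sum_range_add]
  simp only [walk, add_comm k]

theorem measurable_walk (n : ℕ) : Measurable (walk n) := by
  unfold walk; fun_prop

variable (ρ : Measure ℝ) [IsProbabilityMeasure ρ]

theorem integral_eval_zero_infinitePi :
    ∫ x : ℕ → ℝ, x 0 ∂(Measure.infinitePi fun _ : ℕ => ρ) = ∫ a, a ∂ρ := by
  have hmp := measurePreserving_eval_infinitePi (fun _ : ℕ => ρ) 0
  conv_rhs => rw [← hmp.map_eq]
  exact (integral_map (f := fun a : ℝ => a) hmp.measurable.aemeasurable
    aestronglyMeasurable_id).symm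

theorem tendsto_walk_atTop (hint : Integrable id ρ) (hmean : 0 < ∫ a, a ∂ρ) :
    ∀ᵐ x ∂(Measure.infinitePi fun _ : ℕ => ρ), Tendsto (fun n => walk n x) atTop atTop := by
  have hmp := fun i => measurePreserving_eval_infinitePi (fun _ : ℕ => ρ) i
  have hslln := strong_law_ae_real (μ := Measure.infinitePi fun _ : ℕ => ρ)
    (fun i (x : ℕ → ℝ) => x i) ((hmp 0).integrable_comp_of_integrable hint)
    (fun i j hij => (iIndepFun_infinitePi (P := fun _ : ℕ => ρ) (X := fun _ a => a)
      (by fun_prop)).indepFun hij)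
    (fun i => ⟨(hmp i).measurable.aemeasurable, (hmp 0).measurable.aemeasurable,
      (hmp i).map_eq.trans (hmp 0).map_eq.symm⟩)
  filter_upwards [hslln] with x hx
  rw [integral_eval_zero_infinitePi] at hx
  have h := hx.pos_mul_atTop hmean tendsto_natCast_atTop_atTop
  refine h.congr' ?_
  filter_upwards [eventually_gt_atTop 0] with n hn
  have : (n : ℝ) ≠ 0 := by positivity
  simp only [walk]
  field_simp

theorem ae_shift_infinitePi {p : (ℕ → ℝ) → Prop} (hp : MeasurableSet {x | p x})
    (h : ∀ᵐ x ∂(Measure.infinitePi fun _ : ℕ => ρ), p x) (k : ℕ) :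
    ∀ᵐ x ∂(Measure.infinitePi fun _ : ℕ => ρ), p fun i => x (i + k) := by
  have hk := Measure.map_infinitePi_infinitePi_of_inj (P := fun _ : ℕ => ρ)
    (f := fun i => i + k) (fun a b hab => by simpa using hab)
  rw [← hk, ae_map_iff (Measurable.aemeasurable (by fun_prop)) hp] at h
  exact h

/-- A random walk with integrable steps that becomes negative almost surely has no positive
drift. -/
theorem mean_nonpos_of_ae_exists_walk_neg (hint : Integrable id ρ)
    (h : ∀ᵐ x ∂(Measure.infinitePi fun _ : ℕ => ρ), ∃ n, walk n x < 0) : ∫ a, a ∂ρ ≤ 0 := by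
  by_contra! hpos
  have hmeas : MeasurableSet {x : ℕ → ℝ | ∃ n, walk n x < 0} := by
    have : {x : ℕ → ℝ | ∃ n, walk n x < 0} = ⋃ n, {x | walk n x < 0} := by
      ext x; simp
    rw [this]
    exact MeasurableSet.iUnion fun n => measurableSet_lt (measurable_walk n) measurable_const
  -- Applied to all shifts at once, the hypothesis says that from every index the walk later falls
  -- strictly below its current value, so it has no minimum.
  have hall := ae_all_iff.2 fun k => ae_shift_infinitePi ρ hmeas h k
  obtain ⟨x, hx, hlim⟩ := (hall.and (tendsto_walk_atTop ρ hint hpos)).exists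
  -- a minimizing index exists since the walk tends to infinity
  obtain ⟨k, hk⟩ : ∃ k, ∀ n, walk k x ≤ walk n x := by
    obtain ⟨M, hM⟩ := (hlim.eventually_ge_atTop 0).exists_forall_of_atTop
    obtain ⟨k, -, hk⟩ := Finset.exists_min_image (Finset.range (M + 1)) (fun n => walk n x)
      ⟨0, by simp⟩
    refine ⟨k, fun n => ?_⟩
    by_cases hn : n < M + 1
    · exact hk n (Finset.mem_range.2 hn)
    · have h0 : walk k x ≤ 0 := by simpa using hk 0 (by simp)
      exact h0.trans (hM n (by omega))
  obtain ⟨n, hn⟩ := hx k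
  have := hk (k + n)
  rw [walk_add] at this
  linarith

/-! ### The infimum of a random walk with nonpositive drift -/

/-- The exponential of the infimum of the walk. -/
def expInf (x : ℕ → ℝ) : ℝ := ⨅ n, Real.exp (walk n x)

theorem bddBelow_exp_walk (x : ℕ → ℝ) : BddBelow (Set.range fun n => Real.exp (walk n x)) :=
  ⟨0, by rintro _ ⟨n, rfl⟩; positivity⟩

theorem expInf_nonneg (x : ℕ → ℝ) : 0 ≤ expInf x := le_ciInf fun n => by positivity

theorem expInf_le_one (x : ℕ → ℝ) : expInf x ≤ 1 :=
  (ciInf_le (bddBelow_exp_walk x) 0).trans (by simp)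

theorem measurable_expInf : Measurable expInf :=
  Measurable.iInf fun n => Real.measurable_exp.comp (measurable_walk n)

/-- The infimum `I` of the walk, which starts at 0, satisfies `I = min 0 (x 0 + I')` with `I'` the
infimum of the shifted walk. In exponential form this stays meaningful when the infimum is `-∞`,
encoded as 0. -/
theorem expInf_eq_min (x : ℕ → ℝ) :
    expInf x = min 1 (Real.exp (x 0) * expInf fun i => x (i + 1)) := by
  apply le_antisymm
  · refine le_min (expInf_le_one x) ?_
    unfold expInf
    rw [Real.mul_iInf_of_nonneg (by positivity)]
    refine le_ciInf fun n => ?_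
    rw [← Real.exp_add, ← walk_succ']
    exact ciInf_le (bddBelow_exp_walk x) (n + 1)
  · refine le_ciInf fun n => ?_
    cases n with
    | zero => simp
    | succ n =>
      refine (min_le_right _ _).trans ?_
      rw [walk_succ', Real.exp_add]
      exact mul_le_mul_of_nonneg_left (ciInf_le (bddBelow_exp_walk _) n) (by positivity)

/-- The infimum of the walk, truncated at `-K`. -/
def truncInf (K : ℕ) (x : ℕ → ℝ) : ℝ := Real.log (max (expInf x) (Real.exp (-K)))

theorem measurable_truncInf (K : ℕ) : Measurable (truncInf K) :=
  Real.measurable_log.comp (measurable_expInf.max measurable_const)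

theorem abs_truncInf_le (K : ℕ) (x : ℕ → ℝ) : |truncInf K x| ≤ K := by
  rw [abs_le]
  constructor
  · unfold truncInf
    rw [Real.le_log_iff_exp_le (by positivity)]
    exact le_max_right _ _
  · refine (Real.log_nonpos (by positivity) ?_).trans (by positivity)
    exact max_le (expInf_le_one x) (Real.exp_le_one_iff.2 (by simp))

/-- Dropping the first step moves the infimum by at most the size of that step, and truncation does
not increase the difference. The bound is uniform in `K` and serves as the dominating function. -/
theorem abs_truncInf_sub_le (K : ℕ) (x : ℕ → ℝ) :
    |truncInf K x - truncInf K fun i => x (i + 1)| ≤ |x 0| := by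
  have hle : ∀ a b : ℝ, 0 < a → 0 < b → a ≤ Real.exp |x 0| * b →
      Real.log a - Real.log b ≤ |x 0| := by
    intro a b ha hb hab
    have := Real.log_le_log ha hab
    rw [Real.log_mul (by positivity) hb.ne', Real.log_exp] at this
    linarith
  have hone : 1 ≤ Real.exp |x 0| := Real.one_le_exp (abs_nonneg _)
  have hE := expInf_nonneg fun i => x (i + 1)
  have hE1 := expInf_le_one fun i => x (i + 1)
  have hK : 0 < Real.exp (-(K : ℝ)) := Real.exp_pos _
  rw [abs_le]
  constructor
  · rw [neg_le, neg_sub]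
    refine hle _ _ (by positivity) (by positivity) ?_
    rw [expInf_eq_min x]
    have h1 : Real.exp (-|x 0|) ≤ Real.exp (x 0) := Real.exp_le_exp.2 (neg_abs_le _)
    have h2 : Real.exp |x 0| * Real.exp (-|x 0|) = 1 := by rw [← Real.exp_add]; simp
    refine max_le ?_ ?_
    · refine le_trans ?_ (mul_le_mul_of_nonneg_left (le_max_left _ _) (by positivity))
      rw [mul_min_of_nonneg _ _ (by positivity)]
      refine le_min (by nlinarith) ?_
      calc (expInf fun i => x (i + 1))
          = Real.exp |x 0| * (Real.exp (-|x 0|) * expInf fun i => x (i + 1)) := by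
            rw [← mul_assoc, h2, one_mul]
        _ ≤ _ := by gcongr
    · calc Real.exp (-(K : ℝ)) ≤ Real.exp |x 0| * Real.exp (-(K : ℝ)) := by nlinarith
        _ ≤ _ := mul_le_mul_of_nonneg_left (le_max_right _ _) (by positivity)
  · refine hle _ _ (by positivity) (by positivity) ?_
    rw [expInf_eq_min x]
    have h1 : Real.exp (x 0) ≤ Real.exp |x 0| := Real.exp_le_exp.2 (le_abs_self _)
    rw [mul_max_of_nonneg _ _ (by positivity)]
    refine max_le_max ?_ (by nlinarith)
    exact (min_le_right _ _).trans (by gcongr)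

/-- The limit of `x 0 - truncInf K x + truncInf K (shifted x)` as `K → ∞`. -/
theorem tendsto_truncInf_sub (x : ℕ → ℝ) :
    Tendsto (fun K : ℕ => x 0 - truncInf K x + truncInf K fun i => x (i + 1)) atTop
      (𝓝 (if (expInf fun i => x (i + 1)) = 0 then x 0
        else max 0 (x 0 + Real.log (expInf fun i => x (i + 1))))) := by
  -- If the shifted infimum is `-∞`, both truncated infima equal `-K` and cancel. Otherwise the
  -- truncation is eventually inactive and the recursion gives the positive part.
  split_ifs with h
  · have h0 : expInf x = 0 := by rw [expInf_eq_min, h]; simp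
    refine tendsto_const_nhds.congr fun K => ?_
    simp [truncInf, h, h0]
  · have hpos : 0 < expInf fun i => x (i + 1) := lt_of_le_of_ne (expInf_nonneg _) (Ne.symm h)
    have hpos' : 0 < expInf x := by rw [expInf_eq_min]; positivity
    have hev : ∀ y, 0 < expInf y → ∀ᶠ K : ℕ in atTop, truncInf K y = Real.log (expInf y) := by
      intro y hy
      have : Tendsto (fun K : ℕ => Real.exp (-(K : ℝ))) atTop (𝓝 0) :=
        Real.tendsto_exp_neg_atTop_nhds_zero.comp tendsto_natCast_atTop_atTop
      filter_upwards [this.eventually_lt_const hy] with K hK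
      rw [truncInf, max_eq_left hK.le]
    refine tendsto_const_nhds.congr' ?_
    filter_upwards [hev _ hpos, hev _ hpos'] with K h1 h2
    rw [h1, h2, expInf_eq_min x]
    rcases le_total 1 (Real.exp (x 0) * expInf fun i => x (i + 1)) with h3 | h3
    · rw [min_eq_left h3, Real.log_one, max_eq_right]
      · ring
      · have := Real.log_nonneg h3
        rwa [Real.log_mul (by positivity) hpos.ne', Real.log_exp] at this
    · rw [min_eq_right h3, max_eq_left]
      · rw [Real.log_mul (by positivity) hpos.ne', Real.log_exp]; ring
      · have := Real.log_nonpos (by positivity) h3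
        rwa [Real.log_mul (by positivity) hpos.ne', Real.log_exp] at this

theorem integral_zero_tail_infinitePi {g : ℝ × (ℕ → ℝ) → ℝ} (hg : Measurable g) :
    ∫ x : ℕ → ℝ, g (x 0, fun i => x (i + 1)) ∂(Measure.infinitePi fun _ : ℕ => ρ)
      = ∫ p, g p ∂(ρ.prod (Measure.infinitePi fun _ : ℕ => ρ)) := by
  rw [← map_zero_tail_infinitePi,
    integral_map (Measurable.aemeasurable (by fun_prop)) hg.aestronglyMeasurable]

/-- A nondegenerate random walk with integrable steps and nonpositive drift is unbounded below. -/
theorem ae_exists_walk_lt (hint : Integrable id ρ) (hmean : ∫ a, a ∂ρ ≤ 0)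
    (hnd : ¬ ∀ᵐ a ∂ρ, a = 0) :
    ∀ᵐ x ∂(Measure.infinitePi fun _ : ℕ => ρ), ∀ b : ℝ, ∃ n, walk n x < b := by
  set κ : Measure (ℕ → ℝ) := Measure.infinitePi fun _ : ℕ => ρ with hR
  have hmp0 := measurePreserving_eval_infinitePi (fun _ : ℕ => ρ) 0
  have hint0 : Integrable (fun x : ℕ → ℝ => x 0) κ := hmp0.integrable_comp_of_integrable hint
  have hmean0 : ∫ x : ℕ → ℝ, x 0 ∂κ = ∫ a, a ∂ρ := integral_eval_zero_infinitePi ρ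
  have hshift : MeasurePreserving (fun (x : ℕ → ℝ) i => x (i + 1)) κ κ :=
    ⟨by fun_prop, Measure.map_infinitePi_infinitePi_of_inj (P := fun _ : ℕ => ρ)
      (f := fun i => i + 1) (fun a b hab => by simpa using hab)⟩
  set h : (ℕ → ℝ) → ℝ := fun x => if (expInf fun i => x (i + 1)) = 0 then x 0
        else max 0 (x 0 + Real.log (expInf fun i => x (i + 1))) with hh
  -- By shift invariance the two bounded truncated infima have the same mean, so only the mean of
  -- the first step remains. Without truncation they need not be integrable.
  have hK : ∀ K : ℕ,
      ∫ x : ℕ → ℝ, (x 0 - truncInf K x + truncInf K fun i => x (i + 1)) ∂κ = ∫ a, a ∂ρ := by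
    intro K
    have hi : Integrable (truncInf K) κ :=
      Integrable.of_bound (measurable_truncInf K).aestronglyMeasurable K
        (Eventually.of_forall fun x => abs_truncInf_le K x)
    have hi' : Integrable (fun x : ℕ → ℝ => truncInf K fun i => x (i + 1)) κ :=
      hshift.integrable_comp_of_integrable hi
    have hs : Integrable (fun x : ℕ → ℝ => x 0 - truncInf K x) κ := hint0.sub hi
    rw [integral_add hs hi', integral_sub hint0 hi, hmean0]
    have : ∫ x : ℕ → ℝ, (truncInf K fun i => x (i + 1)) ∂κ = ∫ x, truncInf K x ∂κ := by
      conv_rhs => rw [← hshift.map_eq]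
      rw [integral_map hshift.measurable.aemeasurable (measurable_truncInf K).aestronglyMeasurable]
    rw [this]; ring
  have hshm : Measurable fun x : ℕ → ℝ => expInf fun i => x (i + 1) :=
    measurable_expInf.comp (by fun_prop)
  have hhm : Measurable h := by
    refine Measurable.ite (hshm (measurableSet_singleton 0)) (by fun_prop) ?_
    exact measurable_const.max ((measurable_pi_apply 0).add (Real.measurable_log.comp hshm))
  have hbound : ∀ (K : ℕ) (x : ℕ → ℝ),
      ‖x 0 - truncInf K x + truncInf K fun i => x (i + 1)‖ ≤ 2 * |x 0| := by
    intro K x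
    have h1 := abs_truncInf_sub_le K x
    have h2 := abs_sub (x 0) (truncInf K x - truncInf K fun i => x (i + 1))
    rw [Real.norm_eq_abs]
    calc _ = |x 0 - (truncInf K x - truncInf K fun i => x (i + 1))| := by congr 1; ring
      _ ≤ _ := by linarith
  have hlim := tendsto_integral_of_dominated_convergence (μ := κ) (fun x => 2 * |x 0|)
    (F := fun (K : ℕ) x => x 0 - truncInf K x + truncInf K fun i => x (i + 1)) (f := h)
    (fun K => (((measurable_pi_apply 0).sub (measurable_truncInf K)).add
      ((measurable_truncInf K).comp (by fun_prop))).aestronglyMeasurable)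
    (hint0.abs.const_mul 2) (fun K => Eventually.of_forall (hbound K))
    (Eventually.of_forall tendsto_truncInf_sub)
  simp only [hK] at hlim
  have hint_h : ∫ x, h x ∂κ = ∫ a, a ∂ρ := tendsto_nhds_unique tendsto_const_nhds hlim |>.symm
  -- on the event that the shifted walk is unbounded below the first step has its usual mean
  set z : (ℕ → ℝ) → ℝ := fun y => if expInf y = 0 then 1 else 0 with hz
  have hzm : Measurable z :=
    Measurable.ite (measurable_expInf (measurableSet_singleton 0)) measurable_const measurable_const
  have hz01 : ∀ y, 0 ≤ z y ∧ z y ≤ 1 := fun y => by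
    simp only [hz]; split_ifs <;> norm_num
  have hzi : Integrable z κ := Integrable.of_bound hzm.aestronglyMeasurable 1
    (Eventually.of_forall fun y => by
      rw [Real.norm_eq_abs, abs_of_nonneg (hz01 y).1]; exact (hz01 y).2)
  set q := ∫ y, z y ∂κ with hq
  -- The first step is independent of the event that the rest of the walk is unbounded below, an
  -- event of probability `q`.
  have hzint : ∫ x : ℕ → ℝ, x 0 * z (fun i => x (i + 1)) ∂κ = (∫ a, a ∂ρ) * q := by
    rw [hR, integral_zero_tail_infinitePi ρ (g := fun p => p.1 * z p.2)
      (measurable_fst.mul (hzm.comp measurable_snd))]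
    exact integral_prod_mul (fun a => a) z
  have hxz : Integrable (fun x : ℕ → ℝ => x 0 * z fun i => x (i + 1)) κ := by
    refine hint0.mono (((measurable_pi_apply 0).mul (hzm.comp (by fun_prop))).aestronglyMeasurable)
      (Eventually.of_forall fun x => ?_)
    rw [norm_mul, Real.norm_eq_abs (z _), abs_of_nonneg (hz01 _).1]
    exact mul_le_of_le_one_right (norm_nonneg _) (hz01 _).2
  have hhi : Integrable h κ := by
    refine hint0.mono hhm.aestronglyMeasurable (Eventually.of_forall fun x => ?_)
    have hlog := Real.log_nonpos (expInf_nonneg fun i => x (i + 1)) (expInf_le_one _)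
    simp only [hh, Real.norm_eq_abs]
    split_ifs
    · exact le_rfl
    · rw [abs_of_nonneg (le_max_left _ _)]
      exact max_le (abs_nonneg _) (by linarith [le_abs_self (x 0)])
  have hk0 : ∀ x, 0 ≤ h x - x 0 * z fun i => x (i + 1) := by
    intro x
    simp only [hh, hz]
    split_ifs <;> simp
  have hq01 : q ≤ 1 := by
    have := integral_mono hzi (integrable_const (1 : ℝ)) fun y => (hz01 y).2
    simpa using this
  have hkint : ∫ x, (h x - x 0 * z fun i => x (i + 1)) ∂κ = (∫ a, a ∂ρ) * (1 - q) := by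
    rw [integral_sub hhi hxz, hint_h, hzint]; ring
  -- This number is nonpositive because the drift is, and nonnegative as the integral of a
  -- nonnegative function. Hence that function vanishes almost surely.
  have hkzero : (∫ a, a ∂ρ) * (1 - q) = 0 :=
    le_antisymm (mul_nonpos_of_nonpos_of_nonneg hmean (by linarith))
      (hkint ▸ integral_nonneg hk0)
  have hkae : ∀ᵐ x ∂κ, (h x - x 0 * z fun i => x (i + 1)) = 0 :=
    (integral_eq_zero_iff_of_nonneg hk0 (hhi.sub hxz)).1 (hkint.trans hkzero)
  -- The minimum with 1 in the recursion is therefore never active.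
  have hmul : ∀ᵐ x ∂κ, expInf x = Real.exp (x 0) * expInf fun i => x (i + 1) := by
    filter_upwards [hkae] with x hx
    rw [expInf_eq_min x]
    by_cases h0 : (expInf fun i => x (i + 1)) = 0
    · rw [h0]; simp
    · have hpos : 0 < expInf fun i => x (i + 1) := lt_of_le_of_ne (expInf_nonneg _) (Ne.symm h0)
      simp only [hh, hz, h0, if_false, mul_zero, sub_zero, max_eq_left_iff] at hx
      refine min_eq_right ?_
      rw [← Real.log_nonpos_iff (by positivity), Real.log_mul (by positivity) h0, Real.log_exp]
      exact hx
  have hzero : ∀ᵐ x ∂κ, expInf x = 0 := by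
    by_contra hne
    have hGpos : ∫⁻ x, ENNReal.ofReal (expInf x) ∂κ ≠ 0 := by
      intro h0
      rw [lintegral_eq_zero_iff measurable_expInf.ennreal_ofReal] at h0
      refine hne (h0.mono fun x hx => le_antisymm ?_ (expInf_nonneg x))
      simpa using hx
    have hGtop : ∫⁻ x, ENNReal.ofReal (expInf x) ∂κ ≠ ∞ := by
      refine ne_top_of_le_ne_top ENNReal.one_ne_top ?_
      calc ∫⁻ x, ENNReal.ofReal (expInf x) ∂κ ≤ ∫⁻ _, 1 ∂κ :=
            lintegral_mono fun x => by simpa using expInf_le_one x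
        _ = 1 := by simp
    -- Taking expectations in the multiplicative recursion and cancelling the positive finite mean
    -- of `expInf` gives `E[exp x₀] = 1`. Since `q ≠ 1`, the drift is 0, so equality holds in `E[exp
    -- x₀] ≥ 1 + E[x₀]`, which forces zero steps.
    have hprod : ∫⁻ x, ENNReal.ofReal (expInf x) ∂κ
        = (∫⁻ a, ENNReal.ofReal (Real.exp a) ∂ρ) * ∫⁻ x, ENNReal.ofReal (expInf x) ∂κ := by
      have hgm : Measurable fun p : ℝ × (ℕ → ℝ) =>
          ENNReal.ofReal (Real.exp p.1) * ENNReal.ofReal (expInf p.2) :=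
        (Real.measurable_exp.comp measurable_fst).ennreal_ofReal.mul
          (measurable_expInf.comp measurable_snd).ennreal_ofReal
      calc ∫⁻ x, ENNReal.ofReal (expInf x) ∂κ
          = ∫⁻ x : ℕ → ℝ, ENNReal.ofReal (Real.exp (x 0))
              * ENNReal.ofReal (expInf fun i => x (i + 1)) ∂κ := by
            refine lintegral_congr_ae (hmul.mono fun x hx => ?_)
            simp only [hx, ENNReal.ofReal_mul (Real.exp_pos _).le]
        _ = ∫⁻ p, ENNReal.ofReal (Real.exp p.1) * ENNReal.ofReal (expInf p.2) ∂(ρ.prod κ) := by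
            rw [hR, ← map_zero_tail_infinitePi, lintegral_map hgm (by fun_prop)]
        _ = _ := lintegral_prod_mul Real.measurable_exp.ennreal_ofReal.aemeasurable
            measurable_expInf.ennreal_ofReal.aemeasurable
    have hexp : ∫⁻ a, ENNReal.ofReal (Real.exp a) ∂ρ = 1 := by
      have := hprod.symm
      rwa [ENNReal.mul_eq_right hGpos hGtop] at this
    have hq1 : q ≠ 1 := by
      intro hq1
      have h0 : ∫ y, (1 - z y) ∂κ = 0 := by
        rw [integral_sub (integrable_const _) hzi, ← hq, hq1]; simp
      have hi : Integrable (fun y => 1 - z y) κ := (integrable_const _).sub hzi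
      rw [integral_eq_zero_iff_of_nonneg (fun y => by simpa using (hz01 y).2) hi] at h0
      refine hne (h0.mono fun y hy => ?_)
      by_contra hy0
      simp [hz, hy0] at hy
    have hm0 : ∫ a, a ∂ρ = 0 := by
      rcases mul_eq_zero.1 hkzero with h1 | h1
      · exact h1
      · exact absurd (by linarith) hq1
    have hei : Integrable Real.exp ρ := by
      refine ⟨Real.measurable_exp.aestronglyMeasurable, ?_⟩
      rw [hasFiniteIntegral_iff_ofReal (Eventually.of_forall fun a => (Real.exp_pos a).le), hexp]
      exact ENNReal.one_lt_top
    have he1 : ∫ a, Real.exp a ∂ρ = 1 := by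
      rw [integral_eq_lintegral_of_nonneg_ae (Eventually.of_forall fun a => (Real.exp_pos a).le)
        Real.measurable_exp.aestronglyMeasurable, hexp]
      simp
    have hint' : Integrable (fun a : ℝ => a) ρ := hint
    have hi1 : Integrable (fun a : ℝ => a + 1) ρ := hint'.add (integrable_const _)
    have hi2 : Integrable (fun a : ℝ => Real.exp a - (a + 1)) ρ := hei.sub hi1
    have h0 : ∫ a, (Real.exp a - (a + 1)) ∂ρ = 0 := by
      rw [integral_sub hei hi1, he1,
        integral_add hint' (integrable_const _), hm0]
      simp
    rw [integral_eq_zero_iff_of_nonneg (fun a => by simpa using Real.add_one_le_exp a)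
      hi2] at h0
    refine hnd (h0.mono fun a ha => ?_)
    by_contra ha0
    have := Real.add_one_lt_exp ha0
    simp only [Pi.zero_apply] at ha
    linarith
  filter_upwards [hzero] with x hx b
  obtain ⟨n, hn⟩ := exists_lt_of_ciInf_lt (f := fun n => Real.exp (walk n x)) (a := Real.exp b)
    (show expInf x < Real.exp b by rw [hx]; positivity)
  exact ⟨n, Real.exp_lt_exp.1 hn⟩

end RandomWalk

/-! ### Paths of the aggregate claims process -/

instance : StandardBorelSpace PosReal := measurableSet_Ioi.standardBorel

/-- Only finitely many claims arrive up to time `t`. -/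
def NonExploded (t : ℝ≥0) (ω : Ω) : Prop := ∃ n, (t : ℝ) < T n ω

/-- The sum of the first `n` claims. -/
def claims (n : ℕ) (ω : Ω) : ℝ := ∑ j ∈ Finset.range n, (X j ω : ℝ)

theorem S_eq_claims (t : ℝ≥0) (ω : Ω) : S t ω = claims (N t ω) ω := rfl

@[simp] theorem T_zero (ω : Ω) : T 0 ω = 0 := by simp [T]

theorem T_succ (n : ℕ) (ω : Ω) : T (n + 1) ω = T n ω + W n ω := by
  simp [T, Finset.sum_range_succ]

theorem T_nonneg (n : ℕ) (ω : Ω) : 0 ≤ T n ω := by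
  simpa using (T_strictMono ω).monotone (Nat.zero_le n)

@[simp] theorem claims_zero (ω : Ω) : claims 0 ω = 0 := by simp [claims]

theorem claims_succ (n : ℕ) (ω : Ω) : claims (n + 1) ω = claims n ω + X n ω := by
  simp [claims, Finset.sum_range_succ]

theorem claims_strictMono (ω : Ω) : StrictMono fun n => claims n ω := by
  refine strictMono_nat_of_lt_succ fun n => ?_
  have h : (0 : ℝ) < X n ω := (X n ω).2
  rw [claims_succ]
  linarith

theorem N_eq_of_mem {t : ℝ≥0} {ω : Ω} {n : ℕ} (h1 : T n ω ≤ t) (h2 : (t : ℝ) < T (n + 1) ω) :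
    N t ω = n := by
  cases n with
  | succ n => exact (N_eq_succ_iff t ω n).2 ⟨h1, h2⟩
  | zero =>
    have : {k : ℕ | T (k + 1) ω ≤ t} = ∅ := by
      ext k
      simp only [Set.mem_ofPred_eq, Set.mem_empty_iff_false, iff_false, not_le]
      exact h2.trans_le ((T_strictMono ω).monotone (by omega))
    rw [N, this, Set.ncard_empty]

theorem N_eq_zero_of_not_nonExploded {t : ℝ≥0} {ω : Ω} (h : ¬ NonExploded t ω) : N t ω = 0 := by
  have : {k : ℕ | T (k + 1) ω ≤ t} = Set.univ := by
    ext k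
    simp only [NonExploded, not_exists, not_lt] at h
    simpa using h (k + 1)
  rw [N, this, Set.infinite_univ.ncard]

theorem NonExploded.mono {s t : ℝ≥0} {ω : Ω} (h : NonExploded t ω) (hst : s ≤ t) :
    NonExploded s ω := by
  obtain ⟨n, hn⟩ := h
  exact ⟨n, lt_of_le_of_lt (by exact_mod_cast hst) hn⟩

theorem NonExploded.bounds {t : ℝ≥0} {ω : Ω} (h : NonExploded t ω) :
    T (N t ω) ω ≤ t ∧ (t : ℝ) < T (N t ω + 1) ω := by
  classical
  have hspec := Nat.find_spec h
  have hmin := fun k => Nat.find_min h (m := k)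
  generalize Nat.find h = q at hspec hmin
  cases q with
  | zero =>
    rw [T_zero] at hspec
    exact absurd hspec (not_lt.2 t.2)
  | succ q =>
    have h1 : T q ω ≤ t := not_lt.1 (hmin q (Nat.lt_succ_self q))
    rw [N_eq_of_mem h1 hspec]
    exact ⟨h1, hspec⟩

theorem NonExploded.le_N_iff {t : ℝ≥0} {ω : Ω} (h : NonExploded t ω) (n : ℕ) :
    n ≤ N t ω ↔ T n ω ≤ t := by
  obtain ⟨h1, h2⟩ := h.bounds
  constructor
  · intro hn
    exact ((T_strictMono ω).monotone hn).trans h1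
  · intro hn
    have := (T_strictMono ω).lt_iff_lt.1 (hn.trans_lt h2)
    omega

theorem nonExploded_of_N_pos {t : ℝ≥0} {ω : Ω} (h : 0 < N t ω) : NonExploded t ω := by
  by_contra hn
  rw [N_eq_zero_of_not_nonExploded hn] at h
  exact lt_irrefl _ h

theorem T_le_of_le_N {t : ℝ≥0} {ω : Ω} {n : ℕ} (h : n ≤ N t ω) : T n ω ≤ t := by
  rcases Nat.eq_zero_or_pos n with rfl | hn
  · simp
  · exact ((nonExploded_of_N_pos (hn.trans_le h)).le_N_iff n).1 h

theorem NonExploded.N_mono {s t : ℝ≥0} {ω : Ω} (h : NonExploded t ω) (hst : s ≤ t) :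
    N s ω ≤ N t ω := by
  rw [h.le_N_iff]
  exact (h.mono hst).bounds.1.trans (by exact_mod_cast hst)

theorem claims_lt_S_iff {s : ℝ≥0} {ω : Ω} (n : ℕ) : claims n ω < S s ω ↔ n < N s ω := by
  rw [S_eq_claims]
  exact (claims_strictMono ω).lt_iff_lt

theorem N_zero (ω : Ω) : N 0 ω = 0 := by
  refine N_eq_of_mem (by simp) ?_
  rw [NNReal.coe_zero, zero_add]
  simpa using T_strictMono ω Nat.zero_lt_one

/-- The rational times up to `t`, together with `t` itself. -/
def grid (t : ℝ≥0) : Set ℝ≥0 := {s | s ≤ t ∧ (s = t ∨ ∃ q : ℚ≥0, (q : ℝ≥0) = s)}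

theorem countable_grid (t : ℝ≥0) : (grid t).Countable := by
  refine Set.Countable.mono (s₂ := {t} ∪ Set.range fun q : ℚ≥0 => (q : ℝ≥0)) ?_
    ((Set.countable_singleton t).union (Set.countable_range _))
  rintro s ⟨-, rfl | ⟨q, rfl⟩⟩
  · exact Or.inl rfl
  · exact Or.inr ⟨q, rfl⟩

theorem exists_nnrat_btwn {a b : ℝ} (ha : 0 ≤ a) (hab : a < b) :
    ∃ q : ℚ≥0, a < ((q : ℝ≥0) : ℝ) ∧ ((q : ℝ≥0) : ℝ) < b := by
  obtain ⟨q, h1, h2⟩ := exists_rat_btwn hab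
  have hq : (0 : ℚ) ≤ q := by
    have : (0 : ℝ) < q := ha.trans_lt h1
    exact_mod_cast this.le
  lift q to ℚ≥0 using hq
  have hq : ((q : ℝ≥0) : ℝ) = ((q : ℚ) : ℝ) :=
    (show ((q : ℝ≥0) : ℝ) = (q : ℝ) from rfl).trans (by simp)
  exact ⟨q, hq ▸ h1, hq ▸ h2⟩

/-- The grid contains `t` itself because an arrival may fall exactly on `t`, where no rational time
in `[a, b)` need lie below `t`. -/
theorem exists_mem_grid {t : ℝ≥0} {a b : ℝ} (ha : 0 ≤ a) (hat : a ≤ t) (hab : a < b) :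
    ∃ s ∈ grid t, a ≤ (s : ℝ) ∧ (s : ℝ) < b := by
  rcases hat.lt_or_eq with h | h
  · obtain ⟨q, h1, h2⟩ := exists_nnrat_btwn ha (lt_min h hab)
    have h3 : ((q : ℝ≥0) : ℝ) < t := h2.trans_le (min_le_left _ _)
    exact ⟨q, ⟨by exact_mod_cast h3.le, Or.inr ⟨q, rfl⟩⟩, h1.le, h2.trans_le (min_le_right _ _)⟩
  · exact ⟨t, ⟨le_rfl, Or.inl rfl⟩, h.le, h ▸ hab⟩

/-- Explosion is visible in the claims process: it resets `N t`, hence `S t`, to the default value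
0, although `S` was positive between the first two arrivals. -/
theorem nonExploded_iff_forall_grid (t : ℝ≥0) (ω : Ω) :
    NonExploded t ω ↔ ∀ s ∈ grid t, S s ω ≤ S t ω := by
  constructor
  · intro h s hs
    exact (claims_strictMono ω).monotone (h.N_mono hs.1)
  · intro h
    by_contra hexp
    have hT : T 1 ω ≤ t := by
      simp only [NonExploded, not_exists, not_lt] at hexp
      exact hexp 1
    obtain ⟨s, hs, h1, h2⟩ := exists_mem_grid (T_nonneg 1 ω) hT (T_strictMono ω Nat.one_lt_two)
    have hN : N s ω = 1 := N_eq_of_mem h1 h2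
    have := h s hs
    rw [S_eq_claims, S_eq_claims, hN, N_eq_zero_of_not_nonExploded hexp] at this
    exact absurd (claims_strictMono ω Nat.zero_lt_one) (not_lt.2 this)

theorem NonExploded.congr {t : ℝ≥0} {ω ω' : Ω} (h : ∀ s ∈ grid t, S s ω = S s ω')
    (hω : NonExploded t ω) : NonExploded t ω' := by
  rw [nonExploded_iff_forall_grid] at hω ⊢
  intro s hs
  rw [← h s hs, ← h t ⟨le_rfl, Or.inl rfl⟩]
  exact hω s hs

/-- The values of the aggregate claims process on the grid up to `t` determine the arrival times
and the claims up to `t`. -/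
theorem path_determined {t : ℝ≥0} {ω ω' : Ω} (hω : NonExploded t ω)
    (h : ∀ s ∈ grid t, S s ω = S s ω') {n : ℕ} (hn : n ≤ N t ω) :
    n ≤ N t ω' ∧ T n ω = T n ω' ∧ ∀ j < n, X j ω = X j ω' := by
  have hω' := hω.congr h
  induction n with
  | zero => simp
  | succ n ih =>
    obtain ⟨-, ihT, ihX⟩ := ih (by omega)
    have hcl : claims n ω = claims n ω' := by
      simp only [claims]
      exact Finset.sum_congr rfl fun j hj => by rw [ihX j (Finset.mem_range.1 hj)]
    -- Claims are strictly positive, so the next arrival has occurred by `s` exactly when `S s`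
    -- exceeds the sum of the first `n` claims, a sum common to both paths.
    have hcut : ∀ s ∈ grid t, T (n + 1) ω ≤ s ↔ T (n + 1) ω' ≤ s := by
      intro s hs
      rw [← (hω.mono hs.1).le_N_iff, ← (hω'.mono hs.1).le_N_iff, Nat.succ_le_iff, Nat.succ_le_iff,
        ← claims_lt_S_iff, ← claims_lt_S_iff, hcl, h s hs]
    have h1 : T (n + 1) ω ≤ t := (hω.le_N_iff _).1 hn
    have h1' : T (n + 1) ω' ≤ t := (hcut t ⟨le_rfl, Or.inl rfl⟩).1 h1
    have hT : T (n + 1) ω = T (n + 1) ω' := by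
      apply le_antisymm
      · by_contra! hlt
        obtain ⟨s, hs, hs1, hs2⟩ := exists_mem_grid (T_nonneg _ ω') h1' hlt
        exact absurd ((hcut s hs).2 hs1) (not_le.2 hs2)
      · by_contra! hlt
        obtain ⟨s, hs, hs1, hs2⟩ := exists_mem_grid (T_nonneg _ ω) h1 hlt
        exact absurd ((hcut s hs).1 hs1) (not_le.2 hs2)
    refine ⟨(hω'.le_N_iff _).2 h1', hT, fun j hj => ?_⟩
    rcases Nat.lt_succ_iff_lt_or_eq.1 hj with hj | rfl
    · exact ihX j hj
    -- A grid time after this arrival but before the next one on either path shows the size of the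
    -- claim as the increment of `S`.
    · obtain ⟨s, hs, hs1, hs2⟩ := exists_mem_grid (T_nonneg _ ω) h1
        (lt_min (T_strictMono ω (Nat.lt_succ_self (j + 1)))
          (hT.trans_lt (T_strictMono ω' (Nat.lt_succ_self (j + 1)))))
      have e1 : N s ω = j + 1 := N_eq_of_mem hs1 (hs2.trans_le (min_le_left _ _))
      have e2 : N s ω' = j + 1 := N_eq_of_mem (hT ▸ hs1) (hs2.trans_le (min_le_right _ _))
      have := h s hs
      rw [S_eq_claims, S_eq_claims, e1, e2, claims_succ, claims_succ, hcl] at this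
      exact Subtype.ext (by linarith)

theorem N_determined {t : ℝ≥0} {ω ω' : Ω} (h : ∀ s ∈ grid t, S s ω = S s ω') :
    N t ω = N t ω' := by
  by_cases hω : NonExploded t ω
  · exact le_antisymm (path_determined hω h le_rfl).1
      (path_determined (hω.congr h) (fun s hs => (h s hs).symm) le_rfl).1
  · have hω' : ¬ NonExploded t ω' := fun h' => hω (h'.congr fun s hs => (h s hs).symm)
    rw [N_eq_zero_of_not_nonExploded hω, N_eq_zero_of_not_nonExploded hω']

theorem W_determined {t : ℝ≥0} {ω ω' : Ω} (hω : NonExploded t ω)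
    (h : ∀ s ∈ grid t, S s ω = S s ω') {j : ℕ} (hj : j < N t ω) : W j ω = W j ω' := by
  have h1 := (path_determined hω h hj).2.1
  rw [T_succ, T_succ, (path_determined hω h hj.le).2.1] at h1
  exact Subtype.ext (by linarith)

theorem X_determined {t : ℝ≥0} {ω ω' : Ω} (hω : NonExploded t ω)
    (h : ∀ s ∈ grid t, S s ω = S s ω') {j : ℕ} (hj : j < N t ω) : X j ω = X j ω' :=
  (path_determined hω h hj).2.2 j (Nat.lt_succ_self j)

/-- The aggregate claims process at rational times determines the path. -/
theorem eq_of_forall_S_eq {ω ω' : Ω} (h : ∀ q : ℚ≥0, S q ω = S q ω') : ω = ω' := by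
  have key : ∀ j, W j ω = W j ω' ∧ X j ω = X j ω' := by
    intro j
    obtain ⟨q, h1, h2⟩ := exists_nnrat_btwn (T_nonneg (j + 1) ω)
      (T_strictMono ω (Nat.lt_succ_self (j + 1)))
    have hq : ∀ s ∈ grid (q : ℝ≥0), S s ω = S s ω' := by
      rintro s ⟨-, rfl | ⟨r, rfl⟩⟩
      · exact h q
      · exact h r
    have hω : NonExploded q ω := ⟨_, h2⟩
    have hj : j < N q ω := (hω.le_N_iff (j + 1)).2 h1.le
    exact ⟨W_determined hω hq hj, X_determined hω hq hj⟩
  exact Prod.ext (funext fun j => (key j).1) (funext fun j => (key j).2)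

/-! ### The σ-algebras of the two filtrations -/

theorem measurable_S_filtF {s t : ℝ≥0} (hst : s ≤ t) : Measurable[filtF t] (S s) := by
  have : MeasurableSpace.comap (S s) inferInstance ≤ filtF t :=
    le_iSup₂_of_le (f := fun j (_ : j ≤ t) => MeasurableSpace.comap (S j) inferInstance) s hst
      le_rfl
  exact measurable_iff_comap_le.2 this

theorem measurable_V_filtV {s t : ℝ≥0} (hst : s ≤ t) : Measurable[filtV t] (V s) := by
  have : MeasurableSpace.comap (V s) inferInstance ≤ filtV t :=
    le_iSup₂_of_le (f := fun j (_ : j ≤ t) => MeasurableSpace.comap (V j) inferInstance) s hst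
      le_rfl
  exact measurable_iff_comap_le.2 this

theorem filtF_le_filtH (t : ℝ≥0) : filtF t ≤ filtH t := by
  have : filtF ≤ filtH := le_sup_left
  exact this t

theorem filtV_le_filtH (t : ℝ≥0) : filtV t ≤ filtH t := by
  have : filtV ≤ filtH := le_sup_right
  exact this t

/-- A measurable set that depends only on the aggregate claims up to time `t` belongs to
`filtF t`. -/
theorem measurableSet_filtF {t : ℝ≥0} {A : Set Ω} (hA : MeasurableSet A)
    (hdet : ∀ ω ω', (∀ s ∈ grid t, S s ω = S s ω') → ω ∈ A → ω' ∈ A) :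
    MeasurableSet[filtF t] A := by
  have : Countable (grid t) := (countable_grid t).to_subtype
  have hf : Measurable fun (ω : Ω) (s : grid t) => S (s : ℝ≥0) ω :=
    measurable_pi_lambda _ fun s => measurable_S s
  have hfF : Measurable[filtF t] fun (ω : Ω) (s : grid t) => S (s : ℝ≥0) ω :=
    @measurable_pi_lambda _ _ _ (filtF t) _ _ fun s => measurable_S_filtF s.2.1
  refine measurable_iff_comap_le.1 hfF _ (measurableSet_comap_of_saturated hf hA ?_)
  intro ω ω' h
  exact hdet ω ω' fun s hs => congrFun h ⟨s, hs⟩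

/-- A measurable set that depends only on the aggregate claims up to time `t` and on the forward
recurrence time at `t` belongs to `filtH t`. -/
theorem measurableSet_filtH {t : ℝ≥0} {A : Set Ω} (hA : MeasurableSet A)
    (hdet : ∀ ω ω', (∀ s ∈ grid t, S s ω = S s ω') → V t ω = V t ω' → ω ∈ A → ω' ∈ A) :
    MeasurableSet[filtH t] A := by
  have : Countable (grid t) := (countable_grid t).to_subtype
  have hf : Measurable fun (ω : Ω) => ((fun s : grid t => S (s : ℝ≥0) ω), V t ω) :=
    (measurable_pi_lambda (fun (ω : Ω) (s : grid t) => S (s : ℝ≥0) ω)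
      fun s => measurable_S s).prodMk (measurable_V t)
  have hfF : Measurable[filtH t] fun (ω : Ω) => ((fun s : grid t => S (s : ℝ≥0) ω), V t ω) := by
    refine @Measurable.prodMk _ (filtH t) _ _ _ _ _ _ ?_ ?_
    · exact @measurable_pi_lambda _ _ _ (filtH t) _ _ fun s =>
        (measurable_S_filtF s.2.1).mono (filtF_le_filtH t) le_rfl
    · exact (measurable_V_filtV le_rfl).mono (filtV_le_filtH t) le_rfl
  refine measurable_iff_comap_le.1 hfF _ (measurableSet_comap_of_saturated hf hA ?_)
  intro ω ω' h
  exact hdet ω ω' (fun s hs => congrFun (congrArg Prod.fst h) ⟨s, hs⟩) (congrArg Prod.snd h)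

theorem measurableSet_nonExploded (t : ℝ≥0) : MeasurableSet {ω | NonExploded t ω} := by
  have : {ω | NonExploded t ω} = ⋃ n, {ω | (t : ℝ) < T n ω} := by
    ext ω; simp [NonExploded]
  rw [this]
  exact MeasurableSet.iUnion fun n => measurableSet_lt measurable_const (measurable_T n)

theorem measurableSet_filtF_nonExploded (t : ℝ≥0) :
    MeasurableSet[filtF t] {ω | NonExploded t ω} :=
  measurableSet_filtF (measurableSet_nonExploded t) fun _ _ h hω => NonExploded.congr h hω

/-- The filtration of the aggregate claims process generates the whole σ-algebra. -/
theorem iSup_filtF : (⨆ t, filtF t) = (inferInstance : MeasurableSpace Ω) := by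
  apply le_antisymm (iSup_le fun t => filtF.le t)
  have hf : Measurable fun (ω : Ω) (q : ℚ≥0) => S (q : ℝ≥0) ω :=
    measurable_pi_lambda _ fun q => measurable_S q
  have hf' : Measurable[⨆ t, filtF t] fun (ω : Ω) (q : ℚ≥0) => S (q : ℝ≥0) ω :=
    @measurable_pi_lambda _ _ _ (⨆ t, filtF t) _ _ fun q =>
      (measurable_S_filtF le_rfl).mono (le_iSup (fun t => (filtF t : MeasurableSpace Ω)) (q : ℝ≥0))
        le_rfl
  intro A hA
  refine measurable_iff_comap_le.1 hf' _ (measurableSet_comap_of_saturated hf hA ?_)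
  intro ω ω' h hω
  rwa [← eq_of_forall_S_eq fun q => congrFun h q]

/-- Finite measures that agree on `filtF t` for every `t` are equal. -/
theorem ext_of_filtF {Q Q' : Measure Ω} [IsFiniteMeasure Q]
    (h : ∀ (t : ℝ≥0) (A : Set Ω), MeasurableSet[filtF t] A → Q A = Q' A) : Q = Q' := by
  have hgen : (inferInstance : MeasurableSpace Ω)
      = MeasurableSpace.generateFrom (⋃ t, {A | MeasurableSet[filtF t] A}) := by
    exact ((MeasurableSpace.generateFrom_iUnion_measurableSet
      fun t => (filtF t : MeasurableSpace Ω)).trans iSup_filtF).symm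
  refine ext_of_generate_finite _ hgen
    (isPiSystem_iUnion_of_monotone _
      (fun t => @MeasurableSpace.isPiSystem_measurableSet _ (filtF t))
      fun s t hst => filtF.mono hst) ?_ (h 0 _ MeasurableSet.univ)
  rintro A hA
  obtain ⟨t, ht⟩ := Set.mem_iUnion.1 hA
  exact h t A ht

/-- Membership in a set of `filtF t` depends only on the aggregate claims up to `t`. -/
theorem mem_iff_of_measurableSet_filtF {t : ℝ≥0} {A : Set Ω} (hA : MeasurableSet[filtF t] A)
    {ω ω' : Ω} (h : ∀ s ≤ t, S s ω = S s ω') : ω ∈ A ↔ ω' ∈ A := by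
  -- The path space carries the discrete σ-algebra: only dependence on the path is wanted, not
  -- measurability.
  have hle : (filtF t : MeasurableSpace Ω) ≤ MeasurableSpace.comap
      (fun (ω : Ω) (s : Set.Iic t) => S (s : ℝ≥0) ω) ⊤ :=
    iSup₂_le fun s hs => by
      rintro _ ⟨B, -, rfl⟩
      exact ⟨{f | f ⟨s, hs⟩ ∈ B}, trivial, rfl⟩
  obtain ⟨B, -, rfl⟩ := hle A hA
  have : (fun s : Set.Iic t => S (s : ℝ≥0) ω) = fun s : Set.Iic t => S (s : ℝ≥0) ω' :=
    funext fun s => h s s.2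
  simp only [Set.mem_preimage, this]

/-- Membership in a set of `filtH t` depends only on the aggregate claims and the forward
recurrence times up to `t`. -/
theorem mem_iff_of_measurableSet_filtH {t : ℝ≥0} {A : Set Ω} (hA : MeasurableSet[filtH t] A)
    {ω ω' : Ω} (h : ∀ s ≤ t, S s ω = S s ω' ∧ V s ω = V s ω') : ω ∈ A ↔ ω' ∈ A := by
  have hle : (filtH t : MeasurableSpace Ω) ≤ MeasurableSpace.comap
      (fun (ω : Ω) (s : Set.Iic t) => (S (s : ℝ≥0) ω, V (s : ℝ≥0) ω)) ⊤ := by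
    refine sup_le (iSup₂_le fun s hs => ?_) (iSup₂_le fun s hs => ?_)
    · rintro _ ⟨B, -, rfl⟩
      exact ⟨{f | (f ⟨s, hs⟩).1 ∈ B}, trivial, rfl⟩
    · rintro _ ⟨B, -, rfl⟩
      exact ⟨{f | (f ⟨s, hs⟩).2 ∈ B}, trivial, rfl⟩
  obtain ⟨B, -, rfl⟩ := hle A hA
  have : (fun s : Set.Iic t => (S (s : ℝ≥0) ω, V (s : ℝ≥0) ω))
      = fun s : Set.Iic t => (S (s : ℝ≥0) ω', V (s : ℝ≥0) ω') :=
    funext fun s => Prod.ext (h s s.2).1 (h s s.2).2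
  simp only [Set.mem_preimage, this]

/-- Exactly `n` claims arrive up to time `t`. -/
def arrivals (t : ℝ≥0) (n : ℕ) : Set Ω := {ω | T n ω ≤ t ∧ (t : ℝ) < T (n + 1) ω}

theorem measurableSet_arrivals (t : ℝ≥0) (n : ℕ) : MeasurableSet (arrivals t n) :=
  (measurableSet_le (measurable_T n) measurable_const).inter
    (measurableSet_lt measurable_const (measurable_T (n + 1)))

theorem N_eq_of_mem_arrivals {t : ℝ≥0} {n : ℕ} {ω : Ω} (h : ω ∈ arrivals t n) : N t ω = n :=
  N_eq_of_mem h.1 h.2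

theorem pairwise_disjoint_arrivals (t : ℝ≥0) : Pairwise (Function.onFun Disjoint (arrivals t)) := by
  intro m n hmn
  rw [Function.onFun, Set.disjoint_left]
  intro ω h h'
  exact hmn ((N_eq_of_mem_arrivals h).symm.trans (N_eq_of_mem_arrivals h'))

/-- Exploded paths lie in none of these events, not even for `n = 0`, although `N t` is 0 on them by
default. -/
theorem iUnion_arrivals (t : ℝ≥0) : ⋃ n, arrivals t n = {ω | NonExploded t ω} := by
  ext ω
  simp only [Set.mem_iUnion, Set.mem_ofPred_eq]
  constructor
  · rintro ⟨n, -, h⟩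
    exact ⟨_, h⟩
  · intro h
    exact ⟨N t ω, h.bounds⟩

theorem N_eq_of_arrivals {s t : ℝ≥0} {n : ℕ} {ω ω' : Ω} (hst : s ≤ t) (hω : ω ∈ arrivals t n)
    (hω' : ω' ∈ arrivals t n) (hW : ∀ i < n, W i ω = W i ω') : N s ω = N s ω' ∧ N s ω ≤ n := by
  have hs : (s : ℝ) ≤ t := by exact_mod_cast hst
  have hT : ∀ k ≤ n, T k ω = T k ω' := fun k hk =>
    Finset.sum_congr rfl fun i hi => by rw [hW i (by have := Finset.mem_range.1 hi; omega)]
  constructor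
  · unfold N
    congr 1
    ext k
    simp only [Set.mem_ofPred_eq]
    by_cases hk : k + 1 ≤ n
    · rw [hT _ hk]
    · have h1 := (T_strictMono ω).monotone (show n + 1 ≤ k + 1 by omega)
      have h2 := (T_strictMono ω').monotone (show n + 1 ≤ k + 1 by omega)
      constructor <;> intro h
      · linarith [hω.2]
      · linarith [hω'.2]
  · rw [← N_eq_of_mem_arrivals hω]
    exact NonExploded.N_mono ⟨_, hω.2⟩ hst

theorem S_eq_of_arrivals {s t : ℝ≥0} {n : ℕ} {ω ω' : Ω} (hst : s ≤ t) (hω : ω ∈ arrivals t n)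
    (hω' : ω' ∈ arrivals t n) (hW : ∀ i < n, W i ω = W i ω') (hX : ∀ i < n, X i ω = X i ω') :
    S s ω = S s ω' := by
  obtain ⟨h1, h2⟩ := N_eq_of_arrivals hst hω hω' hW
  rw [S, S, ← h1]
  exact Finset.sum_congr rfl fun i hi => by rw [hX i (by have := Finset.mem_range.1 hi; omega)]

/-- One interarrival time more than for `S` is needed, since the forward recurrence time looks at
the first arrival after `s`. -/
theorem V_eq_of_arrivals {s t : ℝ≥0} {n : ℕ} {ω ω' : Ω} (hst : s ≤ t) (hω : ω ∈ arrivals t n)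
    (hω' : ω' ∈ arrivals t n) (hW : ∀ i < n + 1, W i ω = W i ω') : V s ω = V s ω' := by
  obtain ⟨h1, h2⟩ := N_eq_of_arrivals hst hω hω' fun i hi => hW i (by omega)
  rw [V, V, ← h1, T, T]
  congr 1
  exact Finset.sum_congr rfl fun i hi => by rw [hW i (by have := Finset.mem_range.1 hi; omega)]

/-! ### The canonical measures -/

/-- The measure with density `exp ∘ δ`. -/
def tilt (μ : Measure PosReal) (δ : PosReal → ℝ) : Measure PosReal :=
  μ.withDensity fun w => ENNReal.ofReal (Real.exp (δ w))

theorem lintegral_tilt (μ : Measure PosReal) {δ : PosReal → ℝ} (hδ : Measurable δ) {f : PosReal → ℝ}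
    (hf : Measurable f) :
    ∫⁻ w, ENNReal.ofReal (f w) ∂(tilt μ δ) = ∫⁻ w, ENNReal.ofReal (f w * Real.exp (δ w)) ∂μ := by
  rw [tilt, lintegral_withDensity_eq_lintegral_mul _ (by fun_prop) hf.ennreal_ofReal]
  refine lintegral_congr fun w => ?_
  rw [Pi.mul_apply, mul_comm, ← ENNReal.ofReal_mul' (Real.exp_pos _).le]

theorem measurable_sumγ {γ : PosReal → ℝ} (hγ : Measurable γ) (n : ℕ) : Measurable (sumγ γ n) :=
  Finset.measurable_sum _ fun j _ => hγ.comp (measurable_X j)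

theorem measurable_sumδ {δ : PosReal → ℝ} (hδ : Measurable δ) (n : ℕ) : Measurable (sumδ δ n) :=
  Finset.measurable_sum _ fun j _ => hδ.comp (measurable_W j)

section Canonical

variable (μ ν : Measure PosReal) [IsProbabilityMeasure μ] [IsProbabilityMeasure ν]

instance : IsProbabilityMeasure (canonical μ ν) := by
  unfold canonical; infer_instance

theorem measurePreserving_fst_canonical :
    MeasurePreserving Prod.fst (canonical μ ν) (Measure.infinitePi fun _ : ℕ => μ) :=
  measurePreserving_fst

theorem measurePreserving_snd_canonical :
    MeasurePreserving Prod.snd (canonical μ ν) (Measure.infinitePi fun _ : ℕ => ν) :=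
  measurePreserving_snd

theorem measurePreserving_W (n : ℕ) : MeasurePreserving (W n) (canonical μ ν) μ :=
  (measurePreserving_eval_infinitePi (fun _ : ℕ => μ) n).comp
    (measurePreserving_fst_canonical μ ν)

theorem measurePreserving_X (n : ℕ) : MeasurePreserving (X n) (canonical μ ν) ν :=
  (measurePreserving_eval_infinitePi (fun _ : ℕ => ν) n).comp
    (measurePreserving_snd_canonical μ ν)

theorem expect_W {f : PosReal → ℝ} (hf : Measurable f) (n : ℕ) :
    expect (canonical μ ν) (fun ω => f (W n ω)) = ∫⁻ w, ENNReal.ofReal (f w) ∂μ :=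
  (measurePreserving_W μ ν n).lintegral_comp hf.ennreal_ofReal

theorem expect_X {f : PosReal → ℝ} (hf : Measurable f) (n : ℕ) :
    expect (canonical μ ν) (fun ω => f (X n ω)) = ∫⁻ x, ENNReal.ofReal (f x) ∂ν :=
  (measurePreserving_X μ ν n).lintegral_comp hf.ennreal_ofReal

theorem measurable_N_process : Measurable fun (ω : Ω) (t : ℝ≥0) => N t ω :=
  measurable_pi_lambda _ fun t => measurable_N t

theorem isCompoundRenewal_canonical : IsCompoundRenewal (canonical μ ν) where
  indep_W := by
    rw [iIndepFun_iff_map_fun_eq_infinitePi_map measurable_W]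
    simp_rw [(measurePreserving_W μ ν _).map_eq]
    exact (measurePreserving_fst_canonical μ ν).map_eq
  ident_W n := ⟨(measurable_W n).aemeasurable, (measurable_W 0).aemeasurable,
    (measurePreserving_W μ ν n).map_eq.trans (measurePreserving_W μ ν 0).map_eq.symm⟩
  indep_X := by
    rw [iIndepFun_iff_map_fun_eq_infinitePi_map measurable_X]
    simp_rw [(measurePreserving_X μ ν _).map_eq]
    exact (measurePreserving_snd_canonical μ ν).map_eq
  ident_X n := ⟨(measurable_X n).aemeasurable, (measurable_X 0).aemeasurable,
    (measurePreserving_X μ ν n).map_eq.trans (measurePreserving_X μ ν 0).map_eq.symm⟩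
  indep_XN := by
    let x₀ : ℕ → PosReal := fun _ => ⟨1, Set.mem_Ioi.2 one_pos⟩
    have h : Measurable fun (w : ℕ → PosReal) (t : ℝ≥0) => N t (w, x₀) :=
      measurable_N_process.comp (measurable_id.prodMk measurable_const)
    exact (indepFun_prod (μ := Measure.infinitePi fun _ : ℕ => μ)
      (ν := Measure.infinitePi fun _ : ℕ => ν) h measurable_id).symm

/-- The interarrival times are a measurable function of the counting process. -/
theorem measurable_W_comap_N (n : ℕ) :
    Measurable[MeasurableSpace.comap (fun (ω : Ω) (t : ℝ≥0) => N t ω) inferInstance] (W n) := by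
  set m : MeasurableSpace Ω :=
    MeasurableSpace.comap (fun (ω : Ω) (t : ℝ≥0) => N t ω) inferInstance with hm
  have hN : ∀ t, Measurable[m] (N t) := fun t =>
    (measurable_pi_apply t).comp (comap_measurable fun (ω : Ω) (t : ℝ≥0) => N t ω)
  have hT : ∀ n, Measurable[m] (T n) := by
    intro n
    cases n with
    | zero =>
      have : T 0 = fun _ => 0 := funext T_zero
      rw [this]
      exact measurable_const
    | succ n =>
      refine measurable_of_Iio fun a => ?_
      -- An arrival before `a` is seen at a rational time preceding both `a` and the next arrival.
      -- Conversely a count of at least `n + 1` is positive, hence not the default value at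
      -- explosion.
      have : T (n + 1) ⁻¹' Set.Iio a
          = ⋃ (q : ℚ≥0) (_ : ((q : ℝ≥0) : ℝ) < a), N q ⁻¹' Set.Ici (n + 1) := by
        ext ω
        simp only [Set.mem_preimage, Set.mem_Iio, Set.mem_iUnion, Set.mem_Ici, exists_prop]
        constructor
        · intro h
          obtain ⟨q, h1, h2⟩ := exists_nnrat_btwn (T_nonneg (n + 1) ω)
            (lt_min h (T_strictMono ω (Nat.lt_succ_self (n + 1))))
          exact ⟨q, h2.trans_le (min_le_left _ _),
            (N_eq_of_mem h1.le (h2.trans_le (min_le_right _ _))).ge⟩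
        · rintro ⟨q, h1, h2⟩
          exact (T_le_of_le_N h2).trans_lt h1
      rw [this]
      exact MeasurableSet.iUnion fun q => MeasurableSet.iUnion fun _ => hN q measurableSet_Ici
  have hWT : (fun ω => (W n ω : ℝ)) = fun ω => T (n + 1) ω - T n ω := by
    ext ω; rw [T_succ]; ring
  refine @Measurable.subtype_mk _ _ m _ _ (fun ω => (W n ω : ℝ)) ?_ _
  rw [hWT]
  exact (hT (n + 1)).sub (hT n)

/-- A compound renewal measure is the canonical measure of its marginals. -/
theorem IsCompoundRenewal.eq_canonical {Q : Measure Ω} [IsProbabilityMeasure Q]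
    (hQ : IsCompoundRenewal Q) [IsProbabilityMeasure (Q.map (W 0))]
    [IsProbabilityMeasure (Q.map (X 0))] : Q = canonical (Q.map (W 0)) (Q.map (X 0)) := by
  have hWm : Measurable fun (ω : Ω) n => W n ω := measurable_pi_lambda _ measurable_W
  have hXm : Measurable fun (ω : Ω) n => X n ω := measurable_pi_lambda _ measurable_X
  -- Independence from the counting process passes to the interarrival times, as these are functions
  -- of it.
  have hind : IndepFun (fun (ω : Ω) n => W n ω) (fun (ω : Ω) n => X n ω) Q := by
    have h := hQ.indep_XN.symm
    refine indep_of_indep_of_le_left h ?_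
    exact measurable_iff_comap_le.1 (@measurable_pi_lambda _ _ _ (MeasurableSpace.comap
      (fun (ω : Ω) (t : ℝ≥0) => N t ω) inferInstance) _ _ measurable_W_comap_N)
  have h := hind.map_prod_eq_prod_map_map hWm.aemeasurable hXm.aemeasurable
  rw [hQ.indep_W.map_fun_eq_infinitePi_map measurable_W,
    hQ.indep_X.map_fun_eq_infinitePi_map measurable_X] at h
  simp_rw [fun n => (hQ.ident_W n).map_eq, fun n => (hQ.ident_X n).map_eq] at h
  -- The pair of coordinate sequences is the identity of `Ω`, so its law is `Q`.
  exact Measure.map_id.symm.trans h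

theorem integrable_coe {μ : Measure PosReal}
    (hfin : ∫⁻ w : PosReal, ENNReal.ofReal w ∂μ < ∞) : Integrable ((↑) : PosReal → ℝ) μ := by
  refine ⟨measurable_subtype_coe.aestronglyMeasurable, ?_⟩
  rw [hasFiniteIntegral_iff_ofReal (Filter.Eventually.of_forall fun w => w.2.le)]
  exact hfin

/-- Interarrival times are positive, so their mean is positive, and the arrival times tend to
infinity by the strong law. -/
theorem ae_nonExploded (hfin : ∫⁻ w : PosReal, ENNReal.ofReal w ∂μ < ∞) :
    ∀ᵐ ω ∂(canonical μ ν), ∀ t, NonExploded t ω := by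
  have hcoe : Measurable ((↑) : PosReal → ℝ) := measurable_subtype_coe
  have hprob : IsProbabilityMeasure (μ.map ((↑) : PosReal → ℝ)) :=
    Measure.isProbabilityMeasure_map hcoe.aemeasurable
  have hi := integrable_coe hfin
  have hint : Integrable id (μ.map ((↑) : PosReal → ℝ)) :=
    (integrable_map_measure aestronglyMeasurable_id hcoe.aemeasurable).2 hi
  have hmean : 0 < ∫ a, a ∂(μ.map ((↑) : PosReal → ℝ)) := by
    rw [integral_map (f := fun a : ℝ => a) hcoe.aemeasurable aestronglyMeasurable_id,
      integral_pos_iff_support_of_nonneg (fun w => w.2.le) hi]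
    have : Function.support (fun w : PosReal => (w : ℝ)) = Set.univ :=
      Set.eq_univ_of_forall fun w => w.2.ne'
    rw [this]
    simp
  have h := tendsto_walk_atTop _ hint hmean
  rw [← Measure.infinitePi_map_pi (fun _ : ℕ => μ) (f := fun _ => ((↑) : PosReal → ℝ))
    fun _ => hcoe] at h
  have h2 := ae_of_ae_map (Measurable.aemeasurable (by fun_prop)) h
  have h3 := (measurePreserving_fst_canonical μ ν).quasiMeasurePreserving.ae h2
  filter_upwards [h3] with ω hω t
  exact (hω.eventually_gt_atTop (t : ℝ)).exists

theorem lintegral_resample_W (n : ℕ) {f : Ω → ℝ≥0∞} (hf : Measurable f) :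
    ∫⁻ ω, f ω ∂(canonical μ ν)
      = ∫⁻ ω, ∫⁻ w, f (Function.update ω.1 n w, ω.2) ∂μ ∂(canonical μ ν) := by
  have hup : Measurable fun p : (ℕ → PosReal) × PosReal => Function.update p.1 n p.2 := by
    refine measurable_pi_lambda _ fun i => ?_
    by_cases h : i = n
    · subst h; simpa using measurable_snd
    · simp only [Function.update_of_ne h]; fun_prop
  have hm : Measurable fun p : Ω × PosReal => f (Function.update p.1.1 n p.2, p.1.2) :=
    hf.comp ((hup.comp ((measurable_fst.comp measurable_fst).prodMk measurable_snd)).prodMk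
      (measurable_snd.comp measurable_fst))
  unfold canonical
  rw [lintegral_prod_symm' _ hf, lintegral_prod_symm' _ hm.lintegral_prod_right']
  refine lintegral_congr fun x => ?_
  exact lintegral_update_infinitePi μ n (f := fun w => f (w, x))
    (hf.comp (measurable_id.prodMk measurable_const))

variable {γ δ : PosReal → ℝ} [IsProbabilityMeasure (tilt μ δ)] [IsProbabilityMeasure (tilt ν γ)]

/-- Change of measure for functions of the first `m` interarrival times and `n` claims. -/
theorem lintegral_canonical_tilt (hγ : Measurable γ) (hδ : Measurable δ) (m n : ℕ)
    {f : Ω → ℝ≥0∞} (hf : Measurable f)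
    (hdep : ∀ ω ω', (∀ i < m, W i ω = W i ω') → (∀ i < n, X i ω = X i ω') → f ω = f ω') :
    ∫⁻ ω, f ω ∂(canonical (tilt μ δ) (tilt ν γ))
      = ∫⁻ ω, ENNReal.ofReal (Real.exp (sumγ γ n ω + sumδ δ m ω)) * f ω ∂(canonical μ ν) := by
  have hE : ∀ {g : PosReal → ℝ}, Measurable g →
      Measurable fun w => ENNReal.ofReal (Real.exp (g w)) := fun hg => by fun_prop
  -- Finite blocks are padded with 1 to full sequences; by `hdep` the function does not see the
  -- padding, so it factors through the restriction `r`.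
  let ι : ∀ k : ℕ, (Finset.range k → PosReal) → ℕ → PosReal :=
    fun k a i => if h : i ∈ Finset.range k then a ⟨i, h⟩ else ⟨1, Set.mem_Ioi.2 one_pos⟩
  have hι : ∀ k, Measurable (ι k) := fun k => measurable_pi_lambda _ fun i => by
    simp only [ι]; split_ifs <;> fun_prop
  let r : Ω → (Finset.range m → PosReal) × (Finset.range n → PosReal) :=
    Prod.map (Finset.range m).restrict (Finset.range n).restrict
  have hr : Measurable r := by fun_prop
  let g : (Finset.range m → PosReal) × (Finset.range n → PosReal) → ℝ≥0∞ :=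
    fun p => f (ι m p.1, ι n p.2)
  have hg : Measurable g :=
    hf.comp (((hι m).comp measurable_fst).prodMk ((hι n).comp measurable_snd))
  have hfg : ∀ ω, f ω = g (r ω) := fun ω => hdep _ _
    (fun i hi => by simp [W, r, ι, hi, Finset.restrict])
    (fun i hi => by simp [X, r, ι, hi, Finset.restrict])
  have hD : ∀ {h : PosReal → ℝ} (k : ℕ), Measurable h → Measurable fun w : ℕ → PosReal =>
      ∏ i ∈ Finset.range k, ENNReal.ofReal (Real.exp (h (w i))) := fun k hh =>
    Finset.measurable_prod _ fun i _ => (hE hh).comp (measurable_pi_apply i)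
  have hmap : (canonical (tilt μ δ) (tilt ν γ)).map r = ((canonical μ ν).withDensity fun ω =>
      (∏ i ∈ Finset.range m, ENNReal.ofReal (Real.exp (δ (ω.1 i)))) *
        ∏ i ∈ Finset.range n, ENNReal.ofReal (Real.exp (γ (ω.2 i)))).map r := by
    simp only [canonical, r]
    rw [← prod_withDensity (hD m hδ) (hD n hγ),
      ← Measure.map_prod_map _ _ (by fun_prop) (by fun_prop),
      ← Measure.map_prod_map _ _ (by fun_prop) (by fun_prop)]
    congr 1
    · have : IsProbabilityMeasure (μ.withDensity fun w => ENNReal.ofReal (Real.exp (δ w))) :=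
        inferInstanceAs (IsProbabilityMeasure (tilt μ δ))
      exact map_restrict_infinitePi_withDensity μ (hE hδ) m
    · have : IsProbabilityMeasure (ν.withDensity fun w => ENNReal.ofReal (Real.exp (γ w))) :=
        inferInstanceAs (IsProbabilityMeasure (tilt ν γ))
      exact map_restrict_infinitePi_withDensity ν (hE hγ) n
  simp_rw [hfg]
  rw [← lintegral_map hg hr, hmap, lintegral_map hg hr]
  refine (lintegral_withDensity_eq_lintegral_mul _
    (((hD m hδ).comp measurable_fst).mul ((hD n hγ).comp measurable_snd)) (hg.comp hr)).trans ?_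
  refine lintegral_congr fun ω => ?_
  simp only [Pi.mul_apply, Function.comp]
  rw [← ENNReal.ofReal_prod_of_nonneg fun i _ => (Real.exp_pos _).le,
    ← ENNReal.ofReal_prod_of_nonneg fun i _ => (Real.exp_pos _).le,
    ← ENNReal.ofReal_mul (Finset.prod_nonneg fun i _ => (Real.exp_pos _).le),
    ← Real.exp_sum, ← Real.exp_sum, ← Real.exp_add, add_comm]
  rfl

end Canonical

/-! ### Densities on sub-σ-algebras -/

/-- A density on the sub-σ-algebra needs an `m`-measurable version `g`. For the likelihood ratios
this is their restriction to the non-exploded paths. -/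
theorem rnDeriv_trim_of_forall {α : Type*} {m m0 : MeasurableSpace α} (hm : m ≤ m0)
    {P Q : Measure α} [IsFiniteMeasure P] {f g : α → ℝ≥0∞} (hg : Measurable[m] g)
    (hfg : f =ᵐ[P.trim hm] g)
    (h : ∀ A, MeasurableSet[m] A → Q A = ∫⁻ a in A, f a ∂P) :
    (Q.trim hm).rnDeriv (P.trim hm) =ᵐ[P.trim hm] f := by
  have hQ : Q.trim hm = (P.trim hm).withDensity g := by
    refine @Measure.ext _ m _ _ fun A hA => ?_
    rw [trim_measurableSet_eq hm hA, withDensity_apply _ hA, setLIntegral_trim hm hg hA, h A hA]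
    exact lintegral_congr_ae (ae_restrict_of_ae (ae_eq_of_ae_eq_trim hfg))
  rw [hQ]
  exact (Measure.rnDeriv_withDensity (P.trim hm) hg).trans hfg.symm

/-- Absolute continuity rules out a singular part, which the Radon–Nikodym derivative alone would
not detect. -/
theorem eq_setLIntegral_of_rnDeriv_trim {α : Type*} {m m0 : MeasurableSpace α} (hm : m ≤ m0)
    {P Q : Measure α} [IsFiniteMeasure P] [IsFiniteMeasure Q] {f : α → ℝ≥0∞}
    (hac : ∀ A, MeasurableSet[m] A → P A = 0 → Q A = 0)
    (h : (Q.trim hm).rnDeriv (P.trim hm) =ᵐ[P.trim hm] f) {A : Set α} (hA : MeasurableSet[m] A) :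
    Q A = ∫⁻ a in A, f a ∂P := by
  have hac' : Q.trim hm ≪ P.trim hm := by
    refine Measure.AbsolutelyContinuous.mk fun B hB hPB => ?_
    rw [trim_measurableSet_eq hm hB] at hPB ⊢
    exact hac B hB hPB
  rw [← trim_measurableSet_eq hm hA, ← Measure.withDensity_rnDeriv_eq _ _ hac',
    withDensity_apply _ hA, setLIntegral_trim hm (Measure.measurable_rnDeriv _ _) hA]
  exact lintegral_congr_ae (ae_restrict_of_ae (ae_eq_of_ae_eq_trim h))

/-! ### The likelihood ratios -/

theorem measurable_sumγ_N {γ : PosReal → ℝ} (hγ : Measurable γ) (t : ℝ≥0) :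
    Measurable fun ω => sumγ γ (N t ω) ω := by
  have h : Measurable fun p : ℕ × Ω => sumγ γ p.1 p.2 :=
    measurable_from_prod_countable_right fun n => measurable_sumγ hγ n
  exact h.comp ((measurable_N t).prodMk measurable_id)

theorem measurable_sumδ_N {δ : PosReal → ℝ} (hδ : Measurable δ) (t : ℝ≥0) (k : ℕ) :
    Measurable fun ω => sumδ δ (N t ω + k) ω := by
  have h : Measurable fun p : ℕ × Ω => sumδ δ (p.1 + k) p.2 :=
    measurable_from_prod_countable_right fun n => measurable_sumδ hδ (n + k)
  exact h.comp ((measurable_N t).prodMk measurable_id)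

theorem measurable_likeL {γ δ : PosReal → ℝ} (hγ : Measurable γ) (hδ : Measurable δ) (t : ℝ≥0) :
    Measurable (likeL γ δ t) :=
  ((measurable_sumγ_N hγ t).add (measurable_sumδ_N hδ t 1)).exp.ennreal_ofReal

theorem measurable_J (t : ℝ≥0) : Measurable (J t) := by
  have h : Measurable fun p : ℕ × Ω => (t : ℝ) - T p.1 p.2 :=
    measurable_from_prod_countable_right fun n => (measurable_T n).const_sub _
  exact h.comp ((measurable_N t).prodMk measurable_id)

theorem measurable_setLIntegral_tail (μ : Measure PosReal) [SFinite μ] {f : PosReal → ℝ≥0∞}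
    (hf : Measurable f) : Measurable fun a : ℝ => ∫⁻ w in {w : PosReal | a < w}, f w ∂μ := by
  have hs : MeasurableSet {p : ℝ × PosReal | p.1 < (p.2 : ℝ)} :=
    measurableSet_lt measurable_fst (measurable_subtype_coe.comp measurable_snd)
  have h : Measurable fun p : ℝ × PosReal =>
      {p : ℝ × PosReal | p.1 < (p.2 : ℝ)}.indicator (fun p => f p.2) p :=
    (hf.comp measurable_snd).indicator hs
  convert h.lintegral_prod_right' (ν := μ) using 2 with a
  rw [← lintegral_indicator (measurableSet_lt measurable_const measurable_subtype_coe)]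
  rfl

theorem measurable_tail (μ : Measure PosReal) [SFinite μ] :
    Measurable fun a : ℝ => μ {w : PosReal | a < w} := by
  simpa using measurable_setLIntegral_tail μ (f := fun _ => 1) measurable_const

theorem measurable_likeM {P : Measure Ω} [IsFiniteMeasure P] {γ δ : PosReal → ℝ}
    (hγ : Measurable γ) (hδ : Measurable δ) (t : ℝ≥0) : Measurable (likeM P γ δ t) := by
  refine Measurable.mul ?_ (Measurable.div ?_ ?_)
  · exact ((measurable_sumγ_N hγ t).add (measurable_sumδ_N hδ t 0)).exp.ennreal_ofReal
  · exact (measurable_setLIntegral_tail _ hδ.exp.ennreal_ofReal).comp (measurable_J t)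
  · exact (measurable_tail _).comp (measurable_J t)

theorem likeL_pos (γ δ : PosReal → ℝ) (t : ℝ≥0) (ω : Ω) : 0 < likeL γ δ t ω :=
  ENNReal.ofReal_pos.2 (Real.exp_pos _)

theorem likeL_of_mem_arrivals {γ δ : PosReal → ℝ} {t : ℝ≥0} {n : ℕ} {ω : Ω}
    (h : ω ∈ arrivals t n) :
    likeL γ δ t ω = ENNReal.ofReal (Real.exp (sumγ γ n ω + sumδ δ (n + 1) ω)) := by
  rw [likeL, N_eq_of_mem_arrivals h]

theorem sumγ_congr {γ : PosReal → ℝ} {n : ℕ} {ω ω' : Ω} (h : ∀ j < n, X j ω = X j ω') :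
    sumγ γ n ω = sumγ γ n ω' :=
  Finset.sum_congr rfl fun j hj => by rw [h j (Finset.mem_range.1 hj)]

theorem sumδ_congr {δ : PosReal → ℝ} {n : ℕ} {ω ω' : Ω} (h : ∀ j < n, W j ω = W j ω') :
    sumδ δ n ω = sumδ δ n ω' :=
  Finset.sum_congr rfl fun j hj => by rw [h j (Finset.mem_range.1 hj)]

theorem T_congr {n : ℕ} {ω ω' : Ω} (h : ∀ j < n, W j ω = W j ω') : T n ω = T n ω' :=
  Finset.sum_congr rfl fun j hj => by rw [h j (Finset.mem_range.1 hj)]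

/-- The claims path gives all completed interarrival times; the forward recurrence time adds the one
running at `t`, the last that enters `likeL`. -/
theorem likeL_determined {γ δ : PosReal → ℝ} {t : ℝ≥0} {ω ω' : Ω} (hω : NonExploded t ω)
    (h : ∀ s ∈ grid t, S s ω = S s ω') (hV : V t ω = V t ω') :
    likeL γ δ t ω = likeL γ δ t ω' := by
  have hN := N_determined h
  have hW : ∀ j < N t ω, W j ω = W j ω' := fun j hj => W_determined hω h hj
  have hlast : W (N t ω) ω = W (N t ω) ω' := by
    rw [V, V, ← hN, T_succ, T_succ, T_congr hW] at hV
    exact Subtype.ext (by linarith)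
  rw [likeL, likeL, ← hN, sumγ_congr fun j hj => X_determined hω h hj, sumδ_congr (ω' := ω')]
  intro j hj
  rcases Nat.lt_succ_iff_lt_or_eq.1 hj with hj | rfl
  · exact hW j hj
  · exact hlast

theorem likeM_determined {P : Measure Ω} {γ δ : PosReal → ℝ} {t : ℝ≥0} {ω ω' : Ω}
    (hω : NonExploded t ω) (h : ∀ s ∈ grid t, S s ω = S s ω') :
    likeM P γ δ t ω = likeM P γ δ t ω' := by
  have hW : ∀ j < N t ω, W j ω = W j ω' := fun j hj => W_determined hω h hj
  simp only [likeM, J, ← N_determined h, sumγ_congr fun j hj => X_determined hω h hj,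
    sumδ_congr hW, T_congr hW]

theorem measurable_filtF_indicator_likeM {P : Measure Ω} [IsFiniteMeasure P] {γ δ : PosReal → ℝ}
    (hγ : Measurable γ) (hδ : Measurable δ) (t : ℝ≥0) :
    Measurable[filtF t] ({ω | NonExploded t ω}.indicator (likeM P γ δ t)) := by
  intro B hB
  refine measurableSet_filtF
    ((measurable_likeM hγ hδ t).indicator (measurableSet_nonExploded t) hB) fun ω ω' h hω => ?_
  have : {ω | NonExploded t ω}.indicator (likeM P γ δ t) ω'
      = {ω | NonExploded t ω}.indicator (likeM P γ δ t) ω := by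
    by_cases hne : NonExploded t ω
    · rw [Set.indicator_of_mem (show ω ∈ {ω | NonExploded t ω} from hne),
        Set.indicator_of_mem (show ω' ∈ {ω | NonExploded t ω} from hne.congr h),
        likeM_determined hne h]
    · have hne' : ¬ NonExploded t ω' := fun h' => hne (h'.congr fun s hs => (h s hs).symm)
      rw [Set.indicator_of_notMem (show ω ∉ {ω | NonExploded t ω} from hne),
        Set.indicator_of_notMem (show ω' ∉ {ω | NonExploded t ω} from hne')]
  rw [Set.mem_preimage, this]
  exact hω

theorem measurable_filtH_indicator_likeL {γ δ : PosReal → ℝ} (hγ : Measurable γ)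
    (hδ : Measurable δ) (t : ℝ≥0) :
    Measurable[filtH t] ({ω | NonExploded t ω}.indicator (likeL γ δ t)) := by
  intro B hB
  refine measurableSet_filtH
    ((measurable_likeL hγ hδ t).indicator (measurableSet_nonExploded t) hB) fun ω ω' h hV hω => ?_
  have : {ω | NonExploded t ω}.indicator (likeL γ δ t) ω'
      = {ω | NonExploded t ω}.indicator (likeL γ δ t) ω := by
    by_cases hne : NonExploded t ω
    · rw [Set.indicator_of_mem (show ω ∈ {ω | NonExploded t ω} from hne),
        Set.indicator_of_mem (show ω' ∈ {ω | NonExploded t ω} from hne.congr h),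
        likeL_determined hne h hV]
    · have hne' : ¬ NonExploded t ω' := fun h' => hne (h'.congr fun s hs => (h s hs).symm)
      rw [Set.indicator_of_notMem (show ω ∉ {ω | NonExploded t ω} from hne),
        Set.indicator_of_notMem (show ω' ∉ {ω | NonExploded t ω} from hne')]
  rw [Set.mem_preimage, this]
  exact hω

theorem ae_trim_eq_indicator_nonExploded {P : Measure Ω} {t : ℝ≥0}
    (hP : ∀ᵐ ω ∂P, NonExploded t ω) (f : Ω → ℝ≥0∞) {m : MeasurableSpace Ω}
    (hm : m ≤ Prod.instMeasurableSpace) (hmeas : MeasurableSet[m] {ω | NonExploded t ω}) :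
    f =ᵐ[P.trim hm] {ω | NonExploded t ω}.indicator f := by
  have h0 : P.trim hm {ω | NonExploded t ω}ᶜ = 0 := by
    rw [trim_measurableSet_eq hm hmeas.compl]
    exact hP
  have h1 : ∀ᵐ ω ∂(P.trim hm), NonExploded t ω := h0
  filter_upwards [h1] with ω hω
  rw [Set.indicator_of_mem (show ω ∈ {ω | NonExploded t ω} from hω)]

theorem densityH_of_determinedBy {P Q : Measure Ω} [IsFiniteMeasure P] {γ δ : PosReal → ℝ}
    (hγ : Measurable γ) (hδ : Measurable δ) (hP : ∀ᵐ ω ∂P, ∀ t, NonExploded t ω)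
    (h : DeterminedBy P Q γ δ) : DensityH P Q γ δ := by
  intro t
  have hfg := ae_trim_eq_indicator_nonExploded (hP.mono fun _ h => h t) (likeL γ δ t) (filtH.le t)
    (filtF_le_filtH t _ (measurableSet_filtF_nonExploded t))
  exact rnDeriv_trim_of_forall (filtH.le t) (measurable_filtH_indicator_likeL hγ hδ t) hfg (h t)

theorem densityF_of_forall {P Q : Measure Ω} [IsFiniteMeasure P] {γ δ : PosReal → ℝ}
    (hγ : Measurable γ) (hδ : Measurable δ) (hP : ∀ᵐ ω ∂P, ∀ t, NonExploded t ω)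
    (h : ∀ (t : ℝ≥0) (A : Set Ω), MeasurableSet[filtF t] A → Q A = ∫⁻ ω in A, likeM P γ δ t ω ∂P) :
    DensityF P Q γ δ := by
  intro t
  have hfg := ae_trim_eq_indicator_nonExploded (hP.mono fun _ h => h t) (likeM P γ δ t)
    (filtF.le t) (measurableSet_filtF_nonExploded t)
  exact rnDeriv_trim_of_forall (filtF.le t) (measurable_filtF_indicator_likeM hγ hδ t) hfg (h t)

theorem determinedBy_of_densityH {P Q : Measure Ω} [IsFiniteMeasure P] [IsFiniteMeasure Q]
    {γ δ : PosReal → ℝ}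
    (hac : ∀ (t : ℝ≥0) (A : Set Ω), MeasurableSet[filtH t] A → P A = 0 → Q A = 0)
    (h : DensityH P Q γ δ) : DeterminedBy P Q γ δ := fun t _ hA =>
  eq_setLIntegral_of_rnDeriv_trim (filtH.le t) (hac t) (h t) hA

theorem DeterminedBy.unique {P Q Q' : Measure Ω} [IsFiniteMeasure Q] {γ δ : PosReal → ℝ}
    (h : DeterminedBy P Q γ δ) (h' : DeterminedBy P Q' γ δ) : Q = Q' :=
  ext_of_filtF fun t A hA => by
    rw [h t A (filtF_le_filtH t A hA), h' t A (filtF_le_filtH t A hA)]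

/-! ### The likelihood ratio of a tilted canonical measure -/

theorem setLIntegral_eq_tsum_arrivals {R : Measure Ω} {t : ℝ≥0} (hR : ∀ᵐ ω ∂ R, NonExploded t ω)
    {A : Set Ω} (hA : MeasurableSet A) (f : Ω → ℝ≥0∞) :
    ∫⁻ ω in A, f ω ∂ R = ∑' n, ∫⁻ ω in A ∩ arrivals t n, f ω ∂ R := by
  rw [← lintegral_iUnion (fun n => hA.inter (measurableSet_arrivals t n))
    (fun m n hmn => (pairwise_disjoint_arrivals t hmn).mono Set.inter_subset_right
      Set.inter_subset_right), ← Set.inter_iUnion, iUnion_arrivals]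
  refine (setLIntegral_congr ?_).symm
  filter_upwards [hR] with ω hω
  exact propext ⟨fun h => h.1, fun h => ⟨h, hω⟩⟩

variable {μ ν : Measure PosReal} [IsProbabilityMeasure μ] [IsProbabilityMeasure ν]
  {γ δ : PosReal → ℝ} [IsProbabilityMeasure (tilt μ δ)] [IsProbabilityMeasure (tilt ν γ)]

theorem canonical_tilt_apply (hγ : Measurable γ) (hδ : Measurable δ) (m n : ℕ) {B : Set Ω}
    (hB : MeasurableSet B)
    (hdep : ∀ ω ω', (∀ i < m, W i ω = W i ω') → (∀ i < n, X i ω = X i ω') → ω ∈ B → ω' ∈ B) :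
    canonical (tilt μ δ) (tilt ν γ) B
      = ∫⁻ ω in B, ENNReal.ofReal (Real.exp (sumγ γ n ω + sumδ δ m ω)) ∂(canonical μ ν) := by
  have h := lintegral_canonical_tilt μ ν hγ hδ m n
    (f := B.indicator 1) (measurable_one.indicator hB) (fun ω ω' h1 h2 => by
      have hiff : ω ∈ B ↔ ω' ∈ B := ⟨hdep ω ω' h1 h2,
        hdep ω' ω (fun i hi => (h1 i hi).symm) (fun i hi => (h2 i hi).symm)⟩
      by_cases hω : ω ∈ B
      · rw [Set.indicator_of_mem hω, Set.indicator_of_mem (hiff.1 hω)]; rfl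
      · rw [Set.indicator_of_notMem hω, Set.indicator_of_notMem fun h' => hω (hiff.2 h')])
  rw [lintegral_indicator_one hB] at h
  rw [h, ← lintegral_indicator hB]
  refine lintegral_congr fun ω => ?_
  by_cases hω : ω ∈ B
  · simp [hω]
  · simp [hω]

/-- Neither measure charges exploded paths, so the events `arrivals t n` can be treated one by one.
On each of them only finitely many coordinates matter and the density is a finite product. -/
theorem determinedBy_canonical_tilt (hγ : Measurable γ) (hδ : Measurable δ)
    (hP : ∀ᵐ ω ∂(canonical μ ν), ∀ t, NonExploded t ω)
    (hQ : ∀ᵐ ω ∂(canonical (tilt μ δ) (tilt ν γ)), ∀ t, NonExploded t ω) :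
    DeterminedBy (canonical μ ν) (canonical (tilt μ δ) (tilt ν γ)) γ δ := by
  intro t A hA
  have hA' := filtH.le t A hA
  rw [← setLIntegral_one, setLIntegral_eq_tsum_arrivals (hQ.mono fun _ h => h t) hA',
    setLIntegral_eq_tsum_arrivals (hP.mono fun _ h => h t) hA']
  refine tsum_congr fun n => ?_
  have hm := hA'.inter (measurableSet_arrivals t n)
  -- The extra interarrival time decides `t < T (n + 1)` and the value of `V t`; the corresponding
  -- claim lies after `t`.
  rw [setLIntegral_one, canonical_tilt_apply hγ hδ (n + 1) n hm]
  · refine setLIntegral_congr_fun hm fun ω hω => ?_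
    exact (likeL_of_mem_arrivals hω.2).symm
  · rintro ω ω' hW hX ⟨h1, h2⟩
    have h2' : ω' ∈ arrivals t n := by
      refine ⟨?_, ?_⟩
      · rw [← T_congr fun j hj => hW j (by omega)]; exact h2.1
      · rw [← T_congr hW]; exact h2.2
    refine ⟨(mem_iff_of_measurableSet_filtH hA fun s hs => ⟨?_, ?_⟩).1 h1, h2'⟩
    · exact S_eq_of_arrivals hs h2 h2' (fun i hi => hW i (by omega)) hX
    · exact V_eq_of_arrivals hs h2 h2' hW

/-! ### Projecting the likelihood ratio on the filtration of the aggregate claims -/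

/-- The path with the interarrival time of index `n` replaced by `w`. -/
def resample (n : ℕ) (ω : Ω) (w : PosReal) : Ω := (Function.update ω.1 n w, ω.2)

theorem W_resample_of_ne {n i : ℕ} (h : i ≠ n) (ω : Ω) (w : PosReal) :
    W i (resample n ω w) = W i ω := by
  simp [W, resample, Function.update_of_ne h]

@[simp] theorem W_resample_self (n : ℕ) (ω : Ω) (w : PosReal) : W n (resample n ω w) = w := by
  simp [W, resample]

theorem T_resample (n : ℕ) (ω : Ω) (w : PosReal) : T n (resample n ω w) = T n ω :=
  T_congr fun _ hj => W_resample_of_ne hj.ne ω w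

theorem resample_mem_arrivals_iff {t : ℝ≥0} {n : ℕ} {ω : Ω} {w : PosReal} :
    resample n ω w ∈ arrivals t n ↔ T n ω ≤ t ∧ (t : ℝ) - T n ω < w := by
  rw [arrivals, Set.mem_ofPred_eq, T_succ, T_resample, W_resample_self, sub_lt_iff_lt_add']

/-- On the event that exactly `n` claims arrive up to `t`, a set of `filtF t` does not depend on the
interarrival time of index `n`. -/
theorem exists_resample_mem_iff {t : ℝ≥0} {A : Set Ω} (hA : MeasurableSet[filtF t] A) (n : ℕ) :
    ∃ B : Set Ω, ∀ (ω : Ω) (w : PosReal),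
      resample n ω w ∈ A ∩ arrivals t n ↔ ω ∈ B ∧ (t : ℝ) - T n ω < w := by
  -- `t + 1` is a reference interarrival time exceeding `t - T n ω` for every path, as arrival times
  -- are nonnegative.
  have hpos : (t : ℝ) + 1 ∈ Set.Ioi (0 : ℝ) := Set.mem_Ioi.2 (by positivity)
  refine ⟨{ω | T n ω ≤ t ∧ resample n ω ⟨t + 1, hpos⟩ ∈ A}, fun ω w => ?_⟩
  rw [Set.mem_inter_iff, resample_mem_arrivals_iff, Set.mem_ofPred_eq]
  have key : T n ω ≤ t → (t : ℝ) - T n ω < w →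
      (resample n ω w ∈ A ↔ resample n ω ⟨t + 1, hpos⟩ ∈ A) := by
    intro h1 h2
    refine mem_iff_of_measurableSet_filtF hA fun s hs => ?_
    refine S_eq_of_arrivals hs (resample_mem_arrivals_iff.2 ⟨h1, h2⟩)
      (resample_mem_arrivals_iff.2 ⟨h1, ?_⟩) (fun i hi => ?_) fun i _ => rfl
    · change (t : ℝ) - T n ω < (t : ℝ) + 1
      linarith [T_nonneg n ω]
    · rw [W_resample_of_ne hi.ne, W_resample_of_ne hi.ne]
  constructor
  · rintro ⟨h1, h2, h3⟩
    exact ⟨⟨h2, (key h2 h3).1 h1⟩, h3⟩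
  · rintro ⟨⟨h1, h2⟩, h3⟩
    exact ⟨(key h1 h3).2 h2, h1, h3⟩

/-- `likeM` is the conditional expectation of `likeL` given `filtF t`. With exactly `n` arrivals,
such a set restricts the running interarrival time only to `w > t - T n`, so resampling it and
integrating over this ray gives the same value for both. -/
theorem setLIntegral_likeL_eq_likeM {μ ν : Measure PosReal} [IsProbabilityMeasure μ]
    [IsProbabilityMeasure ν] {γ δ : PosReal → ℝ} (hγ : Measurable γ) (hδ : Measurable δ)
    (hP : ∀ᵐ ω ∂(canonical μ ν), ∀ t, NonExploded t ω) {t : ℝ≥0} {A : Set Ω}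
    (hA : MeasurableSet[filtF t] A) :
    ∫⁻ ω in A, likeL γ δ t ω ∂(canonical μ ν)
      = ∫⁻ ω in A, likeM (canonical μ ν) γ δ t ω ∂(canonical μ ν) := by
  have hA' := filtF.le t A hA
  rw [setLIntegral_eq_tsum_arrivals (hP.mono fun _ h => h t) hA',
    setLIntegral_eq_tsum_arrivals (hP.mono fun _ h => h t) hA']
  refine tsum_congr fun n => ?_
  have hm := hA'.inter (measurableSet_arrivals t n)
  obtain ⟨B, hB⟩ := exists_resample_mem_iff hA n
  rw [← lintegral_indicator hm, ← lintegral_indicator hm,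
    lintegral_resample_W μ ν n ((measurable_likeL hγ hδ t).indicator hm),
    lintegral_resample_W μ ν n ((measurable_likeM hγ hδ t).indicator hm)]
  refine lintegral_congr fun ω => ?_
  change ∫⁻ w, (A ∩ arrivals t n).indicator (likeL γ δ t) (resample n ω w) ∂μ
    = ∫⁻ w, (A ∩ arrivals t n).indicator (likeM (canonical μ ν) γ δ t) (resample n ω w) ∂μ
  by_cases hω : ω ∈ B
  · set a : ℝ := (t : ℝ) - T n ω with ha
    set e : ℝ≥0∞ := ENNReal.ofReal (Real.exp (sumγ γ n ω + sumδ δ n ω)) with he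
    set I : ℝ≥0∞ := ∫⁻ w in {w : PosReal | a < w}, ENNReal.ofReal (Real.exp (δ w)) ∂μ with hI
    have hs : MeasurableSet {w : PosReal | a < w} :=
      measurableSet_lt measurable_const measurable_subtype_coe
    have hmem : ∀ w : PosReal, resample n ω w ∈ A ∩ arrivals t n ↔ a < w := fun w => by
      rw [hB]; exact and_iff_right hω
    have hγr : ∀ w, sumγ γ n (resample n ω w) = sumγ γ n ω := fun w => sumγ_congr fun _ _ => rfl
    have hδr : ∀ w, sumδ δ n (resample n ω w) = sumδ δ n ω := fun w =>
      sumδ_congr fun _ hj => W_resample_of_ne hj.ne ω w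
    have hL : ∀ w, (A ∩ arrivals t n).indicator (likeL γ δ t) (resample n ω w)
        = e * {w : PosReal | a < w}.indicator (fun w => ENNReal.ofReal (Real.exp (δ w))) w := by
      intro w
      by_cases hw : a < w
      · rw [Set.indicator_of_mem ((hmem w).2 hw),
          Set.indicator_of_mem (show w ∈ {w : PosReal | a < w} from hw),
          likeL_of_mem_arrivals ((hmem w).2 hw).2, hγr, sumδ, Finset.sum_range_succ, ← sumδ, hδr,
          W_resample_self, ← add_assoc, Real.exp_add, ENNReal.ofReal_mul (Real.exp_pos _).le]
      · rw [Set.indicator_of_notMem fun h => hw ((hmem w).1 h),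
          Set.indicator_of_notMem (show w ∉ {w : PosReal | a < w} from hw), mul_zero]
    have hM : ∀ w, (A ∩ arrivals t n).indicator (likeM (canonical μ ν) γ δ t) (resample n ω w)
        = e * {w : PosReal | a < w}.indicator (fun _ => I / μ {w : PosReal | a < w}) w := by
      intro w
      by_cases hw : a < w
      · rw [Set.indicator_of_mem ((hmem w).2 hw),
          Set.indicator_of_mem (show w ∈ {w : PosReal | a < w} from hw),
          likeM, J, N_eq_of_mem_arrivals ((hmem w).2 hw).2, hγr, hδr, T_resample,
          (measurePreserving_W μ ν 0).map_eq]
      · rw [Set.indicator_of_notMem fun h => hw ((hmem w).1 h),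
          Set.indicator_of_notMem (show w ∉ {w : PosReal | a < w} from hw), mul_zero]
    simp_rw [hL, hM]
    rw [lintegral_const_mul _ (hδ.exp.ennreal_ofReal.indicator hs),
      lintegral_const_mul _ (measurable_const.indicator hs), lintegral_indicator hs,
      lintegral_indicator hs, setLIntegral_const]
    -- If the ray is null, the quotient in `likeM` has denominator 0, but both integrals over the
    -- ray vanish.
    by_cases h0 : μ {w : PosReal | a < w} = 0
    · have : I = 0 := by rw [hI, Measure.restrict_eq_zero.2 h0]; simp
      rw [← hI, this]; simp
    · rw [ENNReal.div_mul_cancel h0 (measure_ne_top _ _)]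
  · have h0 : ∀ (f : Ω → ℝ≥0∞) w, (A ∩ arrivals t n).indicator f (resample n ω w) = 0 :=
      fun f w => Set.indicator_of_notMem (fun h => hω ((hB ω w).1 h).1) _
    simp only [h0]

/-! ### Ruin -/

/-- The increments of the surplus sampled at the claim arrivals. -/
def netIncome (c : ℝ) (ω : Ω) (i : ℕ) : ℝ := c * W i ω - X i ω

theorem walk_netIncome (c : ℝ) (n : ℕ) (ω : Ω) :
    walk n (netIncome c ω) = c * T n ω - claims n ω := by
  simp [walk, netIncome, T, claims, Finset.mul_sum]

theorem measurable_netIncome (c : ℝ) : Measurable (netIncome c) :=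
  measurable_pi_lambda _ fun i =>
    ((measurable_subtype_coe.comp (measurable_W i)).const_mul c).sub
      (measurable_subtype_coe.comp (measurable_X i))

/-- Ruin from initial capital `u` occurs at the `n`-th claim. -/
def ruinAt (c : ℝ) (u : ℝ≥0) (n : ℕ) : Set Ω :=
  {ω | u + walk n (netIncome c ω) < 0 ∧ ∀ m < n, 0 ≤ u + walk m (netIncome c ω)}

theorem measurableSet_ruinAt (c : ℝ) (u : ℝ≥0) (n : ℕ) : MeasurableSet (ruinAt c u n) := by
  have hw : ∀ m, Measurable fun ω => (u : ℝ) + walk m (netIncome c ω) := fun m =>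
    ((measurable_walk m).comp (measurable_netIncome c)).const_add _
  have : ruinAt c u n = {ω | u + walk n (netIncome c ω) < 0} ∩
      ⋂ (m : ℕ) (_ : m < n), {ω | 0 ≤ u + walk m (netIncome c ω)} := by
    ext ω; simp [ruinAt]
  rw [this]
  exact (measurableSet_lt (hw n) measurable_const).inter
    (MeasurableSet.iInter fun m => MeasurableSet.iInter fun _ =>
      measurableSet_le measurable_const (hw m))

theorem pairwise_disjoint_ruinAt (c : ℝ) (u : ℝ≥0) :
    Pairwise (Function.onFun Disjoint (ruinAt c u)) := by
  intro m n hmn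
  rw [Function.onFun, Set.disjoint_left]
  rintro ω ⟨h1, h2⟩ ⟨h3, h4⟩
  rcases lt_or_gt_of_ne hmn with h | h
  · exact absurd (h4 m h) (not_le.2 h1)
  · exact absurd (h2 n h) (not_le.2 h3)

theorem exists_mem_ruinAt_iff (c : ℝ) (u : ℝ≥0) (ω : Ω) :
    (∃ n, ω ∈ ruinAt c u n) ↔ ∃ n, u + walk n (netIncome c ω) < 0 := by
  classical
  constructor
  · rintro ⟨n, h, -⟩
    exact ⟨n, h⟩
  · intro h
    exact ⟨Nat.find h, Nat.find_spec h, fun m hm => not_lt.1 (Nat.find_min h hm)⟩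

theorem surplus_arrival {c : ℝ} {u : ℝ≥0} {n : ℕ} {ω : Ω} {s : ℝ≥0} (hs : (s : ℝ) = T n ω) :
    surplus c u s ω = u + walk n (netIncome c ω) := by
  have hN : N s ω = n := N_eq_of_mem hs.ge (hs ▸ T_strictMono ω (Nat.lt_succ_self n))
  rw [surplus, S_eq_claims, hN, walk_netIncome, hs]
  ring

/-- Between claims the surplus does not decrease, so it is at least its value just after the last
claim. Hence ruin can only occur at arrivals. -/
theorem walk_le_surplus {c : ℝ} (hc : 0 ≤ c) {u t : ℝ≥0} {ω : Ω} (h : NonExploded t ω) :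
    u + walk (N t ω) (netIncome c ω) ≤ surplus c u t ω := by
  rw [surplus, S_eq_claims, walk_netIncome]
  have := mul_le_mul_of_nonneg_left h.bounds.1 hc
  linarith

theorem exists_surplus_neg_iff {c : ℝ} (hc : 0 ≤ c) (u : ℝ≥0) {ω : Ω}
    (h : ∀ t, NonExploded t ω) :
    (∃ t, surplus c u t ω < 0) ↔ ∃ n, u + walk n (netIncome c ω) < 0 := by
  constructor
  · rintro ⟨t, ht⟩
    exact ⟨N t ω, (walk_le_surplus hc (h t)).trans_lt ht⟩
  · rintro ⟨n, hn⟩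
    exact ⟨⟨T n ω, T_nonneg n ω⟩, (surplus_arrival rfl).trans_lt hn⟩

theorem ruinTime_lt_top_iff (c : ℝ) (u : ℝ≥0) (ω : Ω) :
    ruinTime c u ω < ∞ ↔ ∃ t, surplus c u t ω < 0 := by
  simp [ruinTime, iInf_lt_iff]

theorem ruinProb_eq (P : Measure Ω) (c : ℝ) (u : ℝ≥0) :
    ruinProb P c u = P {ω | ∃ t, surplus c u t ω < 0} := by
  unfold ruinProb
  congr 1
  ext ω
  simp only [Set.mem_ofPred_eq, iInf_lt_iff]
  exact exists_congr fun t => by exact_mod_cast Iff.rfl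

/-- The ruin time is then the arrival time `T n`: the surplus is negative there, and a negative
surplus at `t` forces at least `n` arrivals by `t`. -/
theorem N_ruinTime {c : ℝ} (hc : 0 ≤ c) {u : ℝ≥0} {n : ℕ} {ω : Ω} (h : ∀ t, NonExploded t ω)
    (hω : ω ∈ ruinAt c u n) : N (ruinTime c u ω).toNNReal ω = n := by
  obtain ⟨s, hs⟩ : ∃ s : ℝ≥0, (s : ℝ) = T n ω := ⟨⟨T n ω, T_nonneg n ω⟩, rfl⟩
  have heq : ruinTime c u ω = s := by
    apply le_antisymm
    · exact iInf₂_le s ((surplus_arrival hs).trans_lt hω.1)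
    · refine le_iInf₂ fun t ht => ?_
      have hn : n ≤ N t ω := by
        by_contra! hlt
        exact absurd ((walk_le_surplus hc (h t)).trans_lt ht) (not_lt.2 (hω.2 _ hlt))
      have hst : (s : ℝ) ≤ t := hs.trans_le (T_le_of_le_N hn)
      exact_mod_cast hst
  rw [heq, ENNReal.toNNReal_coe]
  exact N_eq_of_mem hs.ge (hs ▸ T_strictMono ω (Nat.lt_succ_self n))

/-- The ruin probability under `P` as an expectation under a tilted measure that makes ruin
certain. -/
theorem ruinRepresentation_canonical_tilt {μ ν : Measure PosReal} [IsProbabilityMeasure μ]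
    [IsProbabilityMeasure ν] {γ δ : PosReal → ℝ} [IsProbabilityMeasure (tilt μ δ)]
    [IsProbabilityMeasure (tilt ν γ)] (hγ : Measurable γ) (hδ : Measurable δ)
    (hP : ∀ᵐ ω ∂(canonical μ ν), ∀ t, NonExploded t ω)
    (hQ : ∀ᵐ ω ∂(canonical (tilt μ δ) (tilt ν γ)), ∀ t, NonExploded t ω)
    {c : ℝ} (hc : 0 ≤ c)
    (hruin : ∀ᵐ ω ∂(canonical (tilt μ δ) (tilt ν γ)),
      ∀ u : ℝ≥0, ∃ n, u + walk n (netIncome c ω) < 0) :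
    RuinRepresentation (canonical μ ν) c (canonical (tilt μ δ) (tilt ν γ)) γ δ := by
  intro u
  set Q := canonical (tilt μ δ) (tilt ν γ) with hQdef
  have hPu : ruinProb (canonical μ ν) c u = ∑' n, canonical μ ν (ruinAt c u n) := by
    rw [ruinProb_eq, ← measure_iUnion (pairwise_disjoint_ruinAt c u) (measurableSet_ruinAt c u)]
    refine measure_congr ?_
    filter_upwards [hP] with ω hω
    refine propext ?_
    change (∃ t, surplus c u t ω < 0) ↔ ω ∈ ⋃ n, ruinAt c u n
    rw [exists_surplus_neg_iff hc u hω, Set.mem_iUnion, exists_mem_ruinAt_iff]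
  -- Ruin is certain under `Q`, so the expectation has no part on the event of no ruin.
  have hcover : ∀ᵐ ω ∂Q, ω ∈ ⋃ n, ruinAt c u n := by
    filter_upwards [hruin] with ω hω
    rw [Set.mem_iUnion, exists_mem_ruinAt_iff]
    exact hω u
  set f : Ω → ℝ≥0∞ := fun ω => ENNReal.ofReal (Real.exp
    (-sumγ γ (N (ruinTime c u ω).toNNReal ω) ω - sumδ δ (N (ruinTime c u ω).toNNReal ω) ω)) with hf
  have hsum : ∫⁻ ω, f ω ∂Q = ∑' n, ∫⁻ ω in ruinAt c u n, f ω ∂Q := by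
    rw [← lintegral_iUnion (measurableSet_ruinAt c u) (pairwise_disjoint_ruinAt c u),
      Measure.restrict_eq_self_of_ae_mem hcover]
  rw [hPu]
  refine Eq.trans ?_ hsum.symm
  refine tsum_congr fun n => ?_
  have hm := measurableSet_ruinAt c u n
  let g : Ω → ℝ≥0∞ := (ruinAt c u n).indicator fun ω =>
    ENNReal.ofReal (Real.exp (-(sumγ γ n ω + sumδ δ n ω)))
  have hgm : Measurable g := Measurable.indicator
    ((measurable_sumγ hγ n).add (measurable_sumδ hδ n)).neg.exp.ennreal_ofReal hm
  -- Ruin at the `n`-th claim involves only `n` interarrival times, unlike the events of `filtH t`.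
  -- Hence the formula has no summand for the next interarrival time, and the change of measure
  -- cancels the integrand exactly.
  have hdep : ∀ ω ω', (∀ i < n, W i ω = W i ω') → (∀ i < n, X i ω = X i ω') → g ω = g ω' := by
    intro ω ω' hW hX
    have hwalk : ∀ m ≤ n, walk m (netIncome c ω) = walk m (netIncome c ω') := fun m hm =>
      Finset.sum_congr rfl fun i hi => by
        have : i < n := (Finset.mem_range.1 hi).trans_le hm
        rw [netIncome, netIncome, hW i this, hX i this]
    have hiff : ω ∈ ruinAt c u n ↔ ω' ∈ ruinAt c u n := by
      simp only [ruinAt, Set.mem_ofPred_eq, hwalk n le_rfl]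
      refine and_congr_right fun _ => forall₂_congr fun m hm => by rw [hwalk m hm.le]
    by_cases hω : ω ∈ ruinAt c u n
    · simp only [g]
      rw [Set.indicator_of_mem hω, Set.indicator_of_mem (hiff.1 hω), sumγ_congr hX, sumδ_congr hW]
    · simp only [g]
      rw [Set.indicator_of_notMem hω, Set.indicator_of_notMem fun h => hω (hiff.2 h)]
  have h1 : ∫⁻ ω in ruinAt c u n, f ω ∂Q = ∫⁻ ω, g ω ∂Q := by
    rw [lintegral_indicator hm]
    refine lintegral_congr_ae ((ae_restrict_iff' hm).2 ?_)
    filter_upwards [hQ] with ω hω hmem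
    simp only [hf]
    rw [N_ruinTime hc hω hmem, neg_add']
  rw [h1, hQdef, lintegral_canonical_tilt μ ν hγ hδ n n hgm hdep, ← lintegral_indicator_one hm]
  refine lintegral_congr fun ω => ?_
  by_cases hω : ω ∈ ruinAt c u n
  · simp only [g]
    rw [Set.indicator_of_mem hω, Set.indicator_of_mem hω, ← ENNReal.ofReal_mul (Real.exp_pos _).le,
      ← Real.exp_add, add_neg_cancel, Real.exp_zero, ENNReal.ofReal_one]
    rfl
  · simp only [g]
    rw [Set.indicator_of_notMem hω, Set.indicator_of_notMem hω, mul_zero]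

/-! ### The random walk of the surplus under a canonical measure -/

section Walk

variable (μ ν : Measure PosReal) [IsProbabilityMeasure μ] [IsProbabilityMeasure ν] (c : ℝ)

/-- The law of `c W - X` for independent `W` and `X` with laws `μ` and `ν`. -/
def incomeLaw : Measure ℝ := (μ.prod ν).map fun p => c * p.1 - p.2

theorem measurable_income : Measurable fun p : PosReal × PosReal => c * (p.1 : ℝ) - p.2 :=
  ((measurable_subtype_coe.comp measurable_fst).const_mul c).sub
    (measurable_subtype_coe.comp measurable_snd)

instance : IsProbabilityMeasure (incomeLaw μ ν c) :=
  Measure.isProbabilityMeasure_map (measurable_income c).aemeasurable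

/-- For fixed claims, the increments lie in a box exactly when the interarrival times lie in a box
depending on the claims coordinatewise; integrating over the claims then factors as well. -/
theorem map_netIncome_canonical :
    (canonical μ ν).map (netIncome c) = Measure.infinitePi fun _ : ℕ => incomeLaw μ ν c := by
  refine Measure.eq_infinitePi _ fun s t ht => ?_
  have hbox : MeasurableSet (Set.pi (s : Set ℕ) t) :=
    MeasurableSet.pi s.countable_toSet fun i _ => ht i
  have hsec : ∀ (y : PosReal) (i : ℕ), MeasurableSet {w : PosReal | c * (w : ℝ) - y ∈ t i} :=
    fun y i => (measurable_income c).comp (measurable_id.prodMk measurable_const) (ht i)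
  rw [Measure.map_apply (measurable_netIncome c) hbox, canonical,
    Measure.prod_apply_symm (measurable_netIncome c hbox)]
  have hslice : ∀ x : ℕ → PosReal, (fun w : ℕ → PosReal => (w, x)) ⁻¹' (netIncome c ⁻¹' Set.pi s t)
      = Set.pi s fun i => {w : PosReal | c * (w : ℝ) - x i ∈ t i} := fun x => rfl
  simp_rw [hslice, fun x : ℕ → PosReal =>
    Measure.infinitePi_pi (fun _ : ℕ => μ) (s := s) fun i _ => hsec (x i) i]
  rw [lintegral_prod_infinitePi ν s (fun i y => μ {w : PosReal | c * (w : ℝ) - y ∈ t i})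
    fun i => measurable_measure_prodMk_right (measurable_income c (ht i))]
  refine Finset.prod_congr rfl fun i _ => ?_
  rw [incomeLaw, Measure.map_apply (measurable_income c) (ht i),
    Measure.prod_apply_symm (measurable_income c (ht i))]
  rfl

theorem ae_netIncome {p : (ℕ → ℝ) → Prop}
    (h : ∀ᵐ x ∂(Measure.infinitePi fun _ : ℕ => incomeLaw μ ν c), p x) :
    ∀ᵐ ω ∂(canonical μ ν), p (netIncome c ω) := by
  rw [← map_netIncome_canonical] at h
  exact ae_of_ae_map (measurable_netIncome c).aemeasurable h

variable {μ ν}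

theorem integrable_income (hW : ∫⁻ w : PosReal, ENNReal.ofReal w ∂μ < ∞)
    (hX : ∫⁻ x : PosReal, ENNReal.ofReal x ∂ν < ∞) :
    Integrable (fun p : PosReal × PosReal => c * (p.1 : ℝ) - p.2) (μ.prod ν) :=
  (((integrable_coe hW).comp_fst ν).const_mul c).sub ((integrable_coe hX).comp_snd μ)

theorem integrable_id_incomeLaw (hW : ∫⁻ w : PosReal, ENNReal.ofReal w ∂μ < ∞)
    (hX : ∫⁻ x : PosReal, ENNReal.ofReal x ∂ν < ∞) : Integrable id (incomeLaw μ ν c) :=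
  (integrable_map_measure aestronglyMeasurable_id (measurable_income c).aemeasurable).2
    (integrable_income c hW hX)

theorem mean_incomeLaw_nonpos_iff (hW : ∫⁻ w : PosReal, ENNReal.ofReal w ∂μ < ∞)
    (hX : ∫⁻ x : PosReal, ENNReal.ofReal x ∂ν < ∞) (hc : 0 ≤ c) :
    ∫ a, a ∂(incomeLaw μ ν c) ≤ 0 ↔
      ENNReal.ofReal c * ∫⁻ w : PosReal, ENNReal.ofReal w ∂μ
        ≤ ∫⁻ x : PosReal, ENNReal.ofReal x ∂ν := by
  have hm : ∀ κ : Measure PosReal, ∫ w : PosReal, (w : ℝ) ∂κ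
      = (∫⁻ w : PosReal, ENNReal.ofReal w ∂κ).toReal := fun κ =>
    integral_eq_lintegral_of_nonneg_ae (Filter.Eventually.of_forall fun w => w.2.le)
      measurable_subtype_coe.aestronglyMeasurable
  have h1 : Integrable (fun p : PosReal × PosReal => c * (p.1 : ℝ)) (μ.prod ν) :=
    ((integrable_coe hW).comp_fst ν).const_mul c
  have h2 : Integrable (fun p : PosReal × PosReal => (p.2 : ℝ)) (μ.prod ν) :=
    (integrable_coe hX).comp_snd μ
  have e1 : ∫ p : PosReal × PosReal, (p.1 : ℝ) ∂(μ.prod ν) = ∫ w : PosReal, (w : ℝ) ∂μ := by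
    simpa using integral_fun_fst (μ := μ) (ν := ν) fun w : PosReal => (w : ℝ)
  have e2 : ∫ p : PosReal × PosReal, (p.2 : ℝ) ∂(μ.prod ν) = ∫ x : PosReal, (x : ℝ) ∂ν := by
    simpa using integral_fun_snd (μ := μ) (ν := ν) fun w : PosReal => (w : ℝ)
  have hint : ∫ a, a ∂(incomeLaw μ ν c)
      = c * (∫⁻ w : PosReal, ENNReal.ofReal w ∂μ).toReal
        - (∫⁻ x : PosReal, ENNReal.ofReal x ∂ν).toReal := by
    rw [incomeLaw, integral_map (f := fun a : ℝ => a) (measurable_income c).aemeasurable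
      aestronglyMeasurable_id, integral_sub h1 h2, integral_const_mul, e1, e2, hm, hm]
  rw [hint, sub_nonpos, ← ENNReal.toReal_le_toReal (ENNReal.mul_ne_top ENNReal.ofReal_ne_top hW.ne)
    hX.ne, ENNReal.toReal_mul, ENNReal.toReal_ofReal hc]

theorem ae_ruin_of_drift (hW : ∫⁻ w : PosReal, ENNReal.ofReal w ∂μ < ∞)
    (hX : ∫⁻ x : PosReal, ENNReal.ofReal x ∂ν < ∞) (hc : 0 ≤ c)
    (hdrift : ENNReal.ofReal c * ∫⁻ w : PosReal, ENNReal.ofReal w ∂μ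
      ≤ ∫⁻ x : PosReal, ENNReal.ofReal x ∂ν)
    (hnd : ¬ ∀ᵐ p ∂(μ.prod ν), c * (p.1 : ℝ) - p.2 = 0) :
    ∀ᵐ ω ∂(canonical μ ν), ∀ u : ℝ≥0, ∃ n, u + walk n (netIncome c ω) < 0 := by
  have hnd' : ¬ ∀ᵐ a ∂(incomeLaw μ ν c), a = 0 := fun h =>
    hnd (ae_of_ae_map (measurable_income c).aemeasurable h)
  filter_upwards [ae_netIncome μ ν c (ae_exists_walk_lt _ (integrable_id_incomeLaw c hW hX)
    ((mean_incomeLaw_nonpos_iff c hW hX hc).2 hdrift) hnd')] with ω hω u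
  obtain ⟨n, hn⟩ := hω (-u)
  exact ⟨n, by linarith⟩

/-- Ruin from any `v ≥ 0` makes the walk itself negative, which cannot be certain under positive
drift. -/
theorem drift_of_ae_ruin (hW : ∫⁻ w : PosReal, ENNReal.ofReal w ∂μ < ∞)
    (hX : ∫⁻ x : PosReal, ENNReal.ofReal x ∂ν < ∞) (hc : 0 ≤ c) (v : ℝ≥0)
    (h : ∀ᵐ ω ∂(canonical μ ν), ∃ n, v + walk n (netIncome c ω) < 0) :
    ENNReal.ofReal c * ∫⁻ w : PosReal, ENNReal.ofReal w ∂μ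
      ≤ ∫⁻ x : PosReal, ENNReal.ofReal x ∂ν := by
  rw [← mean_incomeLaw_nonpos_iff c hW hX hc]
  refine mean_nonpos_of_ae_exists_walk_neg _ (integrable_id_incomeLaw c hW hX) ?_
  have hmeas : MeasurableSet {x : ℕ → ℝ | ∃ n, walk n x < 0} := by
    have : {x : ℕ → ℝ | ∃ n, walk n x < 0} = ⋃ n, {x | walk n x < 0} := by
      ext x; simp
    rw [this]
    exact MeasurableSet.iUnion fun n => measurableSet_lt (measurable_walk n) measurable_const
  rw [← map_netIncome_canonical, ae_map_iff (measurable_netIncome c).aemeasurable hmeas]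
  filter_upwards [h] with ω ⟨n, hn⟩
  exact ⟨n, by linarith [v.2]⟩

end Walk

/-! ### Admissible pairs and ruin-inducing measures -/

/-- The canonical measure with laws tilted by `δ` and `γ`. -/
def canonicalTilt (μ ν : Measure PosReal) (γ δ : PosReal → ℝ) : Measure Ω :=
  (Measure.infinitePi fun _ : ℕ => tilt μ δ).prod (Measure.infinitePi fun _ : ℕ => tilt ν γ)

theorem absolutelyContinuous_tilt (μ : Measure PosReal) {δ : PosReal → ℝ} (hδ : Measurable δ) :
    μ ≪ tilt μ δ :=
  withDensity_absolutelyContinuous' hδ.exp.ennreal_ofReal.aemeasurable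
    (Filter.Eventually.of_forall fun w => (ENNReal.ofReal_pos.2 (Real.exp_pos (δ w))).ne')

/-- Mutual absolute continuity makes the Radon–Nikodym derivative finite and positive almost
everywhere, so its real logarithm can be used. -/
theorem exists_eq_tilt {μ μ' : Measure PosReal} [IsFiniteMeasure μ] [IsFiniteMeasure μ']
    (h : μ' ≪ μ) (h' : μ ≪ μ') : ∃ δ : PosReal → ℝ, Measurable δ ∧ μ' = tilt μ δ := by
  refine ⟨fun w => Real.log (μ'.rnDeriv μ w).toReal,
    (Measure.measurable_rnDeriv μ' μ).ennreal_toReal.log, ?_⟩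
  conv_lhs => rw [← Measure.withDensity_rnDeriv_eq μ' μ h]
  refine withDensity_congr_ae ?_
  filter_upwards [Measure.rnDeriv_lt_top μ' μ, h'.ae_le (Measure.rnDeriv_pos h)] with w h1 h2
  rw [Real.exp_log (ENNReal.toReal_pos h2.ne' h1.ne), ENNReal.ofReal_toReal h1.ne]

theorem tilt_eq_iff {μ : Measure PosReal} {δ δ' : PosReal → ℝ} (hδ : Measurable δ)
    (hδ' : Measurable δ') (hfin : ∫⁻ w, ENNReal.ofReal (Real.exp (δ w)) ∂μ ≠ ∞) :
    tilt μ δ = tilt μ δ' ↔ δ =ᵐ[μ] δ' := by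
  rw [tilt, tilt, withDensity_eq_iff hδ.exp.ennreal_ofReal.aemeasurable
    hδ'.exp.ennreal_ofReal.aemeasurable hfin]
  refine Filter.eventually_congr (Filter.Eventually.of_forall fun w => ?_)
  rw [ENNReal.ofReal_eq_ofReal_iff (Real.exp_pos _).le (Real.exp_pos _).le, Real.exp_eq_exp]

section Classes

variable {μ ν : Measure PosReal} [IsProbabilityMeasure μ] [IsProbabilityMeasure ν] {c : ℝ}
  {γ δ : PosReal → ℝ}

theorem memCP_iff :
    MemCP (canonical μ ν) c γ δ ↔ Measurable γ ∧ Measurable δ ∧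
      IsProbabilityMeasure (tilt ν γ) ∧ IsProbabilityMeasure (tilt μ δ) ∧
      ∫⁻ x : PosReal, ENNReal.ofReal x ∂(tilt ν γ) < ∞ ∧
      ∫⁻ w : PosReal, ENNReal.ofReal w ∂(tilt μ δ) < ∞ ∧
      ENNReal.ofReal c * ∫⁻ w : PosReal, ENNReal.ofReal w ∂(tilt μ δ)
        ≤ ∫⁻ x : PosReal, ENNReal.ofReal x ∂(tilt ν γ) := by
  have hcoe : Measurable ((↑) : PosReal → ℝ) := measurable_subtype_coe
  have hprob : ∀ (κ : Measure PosReal) (η : PosReal → ℝ), IsProbabilityMeasure (tilt κ η) ↔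
      ∫⁻ w, ENNReal.ofReal (Real.exp (η w)) ∂κ = 1 := fun κ η => by
    rw [isProbabilityMeasure_iff, tilt, withDensity_apply _ MeasurableSet.univ,
      Measure.restrict_univ]
  constructor
  · rintro ⟨hγ, hδ, h1, h2, h3, h4, h5⟩
    rw [expect_X μ ν hγ.exp] at h1
    rw [expect_W μ ν hδ.exp] at h2
    rw [expect_X μ ν (f := fun x => x * Real.exp (γ x)) (hcoe.mul hγ.exp)] at h3 h5
    rw [expect_W μ ν (f := fun x => x * Real.exp (δ x)) (hcoe.mul hδ.exp)] at h4 h5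
    rw [lintegral_tilt ν hγ hcoe, lintegral_tilt μ hδ hcoe]
    exact ⟨hγ, hδ, (hprob ν γ).2 h1, (hprob μ δ).2 h2, h3, h4, h5⟩
  · rintro ⟨hγ, hδ, h1, h2, h3, h4, h5⟩
    rw [lintegral_tilt ν hγ hcoe] at h3 h5
    rw [lintegral_tilt μ hδ hcoe] at h4 h5
    refine ⟨hγ, hδ, ?_, ?_, ?_, ?_, ?_⟩
    · rw [expect_X μ ν hγ.exp]; exact (hprob ν γ).1 h1
    · rw [expect_W μ ν hδ.exp]; exact (hprob μ δ).1 h2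
    · rw [expect_X μ ν (f := fun x => x * Real.exp (γ x)) (hcoe.mul hγ.exp)]; exact h3
    · rw [expect_W μ ν (f := fun x => x * Real.exp (δ x)) (hcoe.mul hδ.exp)]; exact h4
    · rw [expect_X μ ν (f := fun x => x * Real.exp (γ x)) (hcoe.mul hγ.exp),
        expect_W μ ν (f := fun x => x * Real.exp (δ x)) (hcoe.mul hδ.exp)]
      exact h5

theorem canonicalTilt_eq_iff {γ' δ' : PosReal → ℝ} (h : MemCP (canonical μ ν) c γ δ)
    (h' : MemCP (canonical μ ν) c γ' δ') :
    canonicalTilt μ ν γ δ = canonicalTilt μ ν γ' δ' ↔ EssEq (canonical μ ν) γ δ γ' δ' := by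
  obtain ⟨hγ, hδ, i1, i2, -⟩ := memCP_iff.1 h
  obtain ⟨hγ', hδ', i3, i4, -⟩ := memCP_iff.1 h'
  have hγ1 := h.norm_γ
  have hδ1 := h.norm_δ
  rw [expect_X μ ν hγ.exp] at hγ1
  rw [expect_W μ ν hδ.exp] at hδ1
  rw [EssEq, (measurePreserving_X μ ν 0).map_eq, (measurePreserving_W μ ν 0).map_eq,
    ← tilt_eq_iff hγ hγ' (hγ1 ▸ ENNReal.one_ne_top),
    ← tilt_eq_iff hδ hδ' (hδ1 ▸ ENNReal.one_ne_top)]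
  constructor
  · intro heq
    refine ⟨?_, ?_⟩
    · rw [← (measurePreserving_X (tilt μ δ) (tilt ν γ) 0).map_eq,
        ← (measurePreserving_X (tilt μ δ') (tilt ν γ') 0).map_eq]
      exact congrArg (Measure.map (X 0)) heq
    · rw [← (measurePreserving_W (tilt μ δ) (tilt ν γ) 0).map_eq,
        ← (measurePreserving_W (tilt μ δ') (tilt ν γ') 0).map_eq]
      exact congrArg (Measure.map (W 0)) heq
  · rintro ⟨h1, h2⟩
    rw [canonicalTilt, canonicalTilt, h1, h2]

/-- The canonical measure tilted by an admissible pair. -/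
theorem canonicalTilt_spec (hc : 0 < c) (hW : ∫⁻ w : PosReal, ENNReal.ofReal w ∂μ < ∞)
    (hNPC : ∫⁻ x : PosReal, ENNReal.ofReal x ∂ν
      < ENNReal.ofReal c * ∫⁻ w : PosReal, ENNReal.ofReal w ∂μ)
    (h : MemCP (canonical μ ν) c γ δ) (v : ℝ≥0) :
    RuinInducing (canonical μ ν) c v (canonicalTilt μ ν γ δ) ∧
      DeterminedBy (canonical μ ν) (canonicalTilt μ ν γ δ) γ δ ∧
      DensityF (canonical μ ν) (canonicalTilt μ ν γ δ) γ δ ∧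
      RuinRepresentation (canonical μ ν) c (canonicalTilt μ ν γ δ) γ δ := by
  obtain ⟨hγ, hδ, i1, i2, h3, h4, h5⟩ := memCP_iff.1 h
  have hP := ae_nonExploded μ ν hW
  have hQ := ae_nonExploded (tilt μ δ) (tilt ν γ) h4
  have hcoe : Measurable ((↑) : PosReal → ℝ) := measurable_subtype_coe
  -- The net profit condition enters here: if `c W = X` held almost surely under the tilted laws, it
  -- would hold under the original ones, and the means of `c W` and `X` would coincide.
  have hnd : ¬ ∀ᵐ p ∂((tilt μ δ).prod (tilt ν γ)), c * (p.1 : ℝ) - p.2 = 0 := by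
    intro h0
    have h0' := ((absolutelyContinuous_tilt μ hδ).prod (absolutelyContinuous_tilt ν hγ)).ae_le h0
    have e1 : ∫⁻ p : PosReal × PosReal, ENNReal.ofReal c * ENNReal.ofReal p.1 ∂(μ.prod ν)
        = ENNReal.ofReal c * ∫⁻ w : PosReal, ENNReal.ofReal w ∂μ := by
      refine (lintegral_const_mul _ (hcoe.comp measurable_fst).ennreal_ofReal).trans ?_
      congr 1
      exact measurePreserving_fst.lintegral_comp (f := fun w : PosReal => ENNReal.ofReal w)
        hcoe.ennreal_ofReal
    have e2 : ∫⁻ p : PosReal × PosReal, ENNReal.ofReal p.2 ∂(μ.prod ν)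
        = ∫⁻ x : PosReal, ENNReal.ofReal x ∂ν :=
      measurePreserving_snd.lintegral_comp (f := fun w : PosReal => ENNReal.ofReal w)
        hcoe.ennreal_ofReal
    refine hNPC.ne' ?_
    rw [← e1, ← e2]
    refine lintegral_congr_ae (Filter.Eventually.mono h0' fun p hp => ?_)
    have hp' : c * (p.1 : ℝ) = p.2 := sub_eq_zero.1 hp
    simp only [← ENNReal.ofReal_mul hc.le, hp']
  have hruin := ae_ruin_of_drift c h4 h3 hc.le h5 hnd
  -- `canonicalTilt` unfolds to `canonical` of the tilted laws; it is stated without the instances,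
  -- which admissibility provides.
  have hdet : DeterminedBy (canonical μ ν) (canonicalTilt μ ν γ δ) γ δ :=
    determinedBy_canonical_tilt hγ hδ hP hQ
  refine ⟨⟨⟨?_, isCompoundRenewal_canonical (tilt μ δ) (tilt ν γ), ?_, ?_, ?_⟩, ?_⟩, hdet, ?_, ?_⟩
  · exact inferInstanceAs (IsProbabilityMeasure (canonical (tilt μ δ) (tilt ν γ)))
  -- The density `likeL` is strictly positive, so the null sets of the two measures in `filtH t`
  -- coincide.
  · intro t A hA
    rw [hdet t A hA, setLIntegral_eq_zero_iff (filtH.le t A hA) (measurable_likeL hγ hδ t)]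
    have : ∀ ω, ¬ (ω ∈ A → likeL γ δ t ω = 0) ↔ ω ∈ A := fun ω =>
      ⟨fun h => by by_contra hω; exact h fun h' => absurd h' hω,
        fun hω h => (likeL_pos γ δ t ω).ne' (h hω)⟩
    rw [ae_iff]
    simp only [this]
    rfl
  · exact (expect_X (tilt μ δ) (tilt ν γ) hcoe 0).trans_lt h3
  · exact (expect_W (tilt μ δ) (tilt ν γ) hcoe 0).trans_lt h4
  · have hae : ∀ᵐ ω ∂(canonical (tilt μ δ) (tilt ν γ)), ω ∈ {ω | ruinTime c v ω < ∞} := by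
      filter_upwards [hQ, hruin] with ω h1 h2
      rw [ruinTime_lt_top_iff, exists_surplus_neg_iff hc.le v h1]
      exact h2 v
    exact (measure_congr (Filter.eventuallyEq_univ.2 hae)).trans
      (measure_univ (μ := canonical (tilt μ δ) (tilt ν γ)))
  · refine densityF_of_forall hγ hδ hP fun t A hA => ?_
    rw [hdet t A (filtF_le_filtH t A hA)]
    exact setLIntegral_likeL_eq_likeM hγ hδ hP hA
  · exact ruinRepresentation_canonical_tilt hγ hδ hP hQ hc.le hruin

theorem canonical_congr {μ μ' ν ν' : Measure PosReal} [IsProbabilityMeasure μ]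
    [IsProbabilityMeasure ν] [IsProbabilityMeasure μ'] [IsProbabilityMeasure ν']
    (h1 : μ = μ') (h2 : ν = ν') : canonical μ ν = canonical μ' ν' := by
  subst h1 h2
  rfl

/-- A compound renewal measure progressively equivalent to `P` has marginals equivalent to those of
`P`. -/
theorem MemMS1.exists_map_eq_tilt {Q : Measure Ω} (hQ : MemMS1 (canonical μ ν) Q) :
    ∃ γ δ : PosReal → ℝ, Measurable γ ∧ Measurable δ ∧ Q.map (W 0) = tilt μ δ ∧
      Q.map (X 0) = tilt ν γ := by
  have := hQ.isProb
  have p1 : IsProbabilityMeasure (Q.map (W 0)) :=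
    Measure.isProbabilityMeasure_map (measurable_W 0).aemeasurable
  have p2 : IsProbabilityMeasure (Q.map (X 0)) :=
    Measure.isProbabilityMeasure_map (measurable_X 0).aemeasurable
  have hPcr := isCompoundRenewal_canonical μ ν
  have hWiff : ∀ B, MeasurableSet B → (Q.map (W 0) B = 0 ↔ μ B = 0) := by
    intro B hB
    -- No claim has arrived at time 0, so the forward recurrence time there is the first
    -- interarrival time.
    have hH : MeasurableSet[filtH 0] (W 0 ⁻¹' B) := by
      refine measurableSet_filtH (measurable_W 0 hB) fun ω ω' _ hV hω => ?_
      have : W 0 ω = W 0 ω' := by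
        simp only [V, N_zero, T_succ, T_zero] at hV
        exact Subtype.ext (by linarith)
      rwa [Set.mem_preimage, ← this]
    rw [Measure.map_apply (measurable_W 0) hB, hQ.progEquiv 0 _ hH,
      (measurePreserving_W μ ν 0).measure_preimage hB.nullMeasurableSet]
  have hXiff : ∀ B, MeasurableSet B → (Q.map (X 0) B = 0 ↔ ν B = 0) := by
    have hNpos : ∀ t, MeasurableSet[filtF t] {ω | 0 < N t ω} := fun t =>
      measurableSet_filtF (measurable_N t measurableSet_Ioi) fun ω ω' h hω => by
        rw [Set.mem_ofPred_eq, ← N_determined h]; exact hω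
    -- The first claim is visible at `t` only if it has arrived. Some `t` gives this positive
    -- probability, since every path has a rational time between its first two arrivals.
    obtain ⟨t, ht⟩ : ∃ t : ℝ≥0, canonical μ ν {ω | 0 < N t ω} ≠ 0 := by
      by_contra! hall
      have h0 : canonical μ ν (⋃ q : ℚ≥0, {ω | 0 < N (q : ℝ≥0) ω}) = 0 :=
        measure_iUnion_null fun q => hall q
      have huniv : (⋃ q : ℚ≥0, {ω : Ω | 0 < N (q : ℝ≥0) ω}) = Set.univ := by
        refine Set.eq_univ_of_forall fun ω => Set.mem_iUnion.2 ?_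
        obtain ⟨q, h1, h2⟩ := exists_nnrat_btwn (T_nonneg 1 ω) (T_strictMono ω Nat.one_lt_two)
        exact ⟨q, by rw [Set.mem_ofPred_eq, N_eq_of_mem h1.le h2]; exact one_pos⟩
      rw [huniv, measure_univ] at h0
      exact one_ne_zero h0
    have htQ : Q {ω | 0 < N t ω} ≠ 0 := fun h0 =>
      ht ((hQ.progEquiv t _ (filtF_le_filtH t _ (hNpos t))).1 h0)
    -- Independence of claims and counting process splits off the factor `R {N t > 0}`, nonzero
    -- under both measures, so null sets of the claim law can be compared.
    have hprod : ∀ R : Measure Ω, IsCompoundRenewal R → ∀ B, MeasurableSet B →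
        R (X 0 ⁻¹' B ∩ {ω | 0 < N t ω}) = R (X 0 ⁻¹' B) * R {ω | 0 < N t ω} := by
      intro R hR B hB
      have h := hR.indep_XN.comp (measurable_pi_apply 0) (measurable_pi_apply t)
      exact h.measure_inter_preimage_eq_mul B (Set.Ioi 0) hB measurableSet_Ioi
    intro B hB
    have hH : MeasurableSet[filtH t] (X 0 ⁻¹' B ∩ {ω | 0 < N t ω}) := by
      refine filtF_le_filtH t _ (measurableSet_filtF ((measurable_X 0 hB).inter
        (measurable_N t measurableSet_Ioi)) fun ω ω' h hω => ?_)
      have hpos : 0 < N t ω := hω.2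
      refine ⟨?_, ?_⟩
      · rw [Set.mem_preimage, ← X_determined (nonExploded_of_N_pos hpos) h hpos]
        exact hω.1
      · rw [Set.mem_ofPred_eq, ← N_determined h]; exact hpos
    have hiff := hQ.progEquiv t _ hH
    rw [hprod Q hQ.crp B hB, hprod _ hPcr B hB, mul_eq_zero, mul_eq_zero, or_iff_left htQ,
      or_iff_left ht] at hiff
    rw [Measure.map_apply (measurable_X 0) hB, hiff,
      (measurePreserving_X μ ν 0).measure_preimage hB.nullMeasurableSet]
  obtain ⟨δ, hδ, hδeq⟩ := exists_eq_tilt (μ := μ) (μ' := Q.map (W 0))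
    (Measure.AbsolutelyContinuous.mk fun B hB h => (hWiff B hB).2 h)
    (Measure.AbsolutelyContinuous.mk fun B hB h => (hWiff B hB).1 h)
  obtain ⟨γ, hγ, hγeq⟩ := exists_eq_tilt (μ := ν) (μ' := Q.map (X 0))
    (Measure.AbsolutelyContinuous.mk fun B hB h => (hXiff B hB).2 h)
    (Measure.AbsolutelyContinuous.mk fun B hB h => (hXiff B hB).1 h)
  exact ⟨γ, δ, hγ, hδ, hδeq, hγeq⟩

/-- Every ruin-inducing measure is a canonical measure tilted by an admissible pair. -/
theorem RuinInducing.exists_pair (hc : 0 < c) {v : ℝ≥0} {Q : Measure Ω}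
    (hQ : RuinInducing (canonical μ ν) c v Q) :
    ∃ γ δ : PosReal → ℝ, MemCP (canonical μ ν) c γ δ ∧ Q = canonicalTilt μ ν γ δ := by
  have := hQ.memMS1.isProb
  obtain ⟨γ, δ, hγ, hδ, h1, h2⟩ := hQ.memMS1.exists_map_eq_tilt
  have p1 : IsProbabilityMeasure (Q.map (W 0)) :=
    Measure.isProbabilityMeasure_map (measurable_W 0).aemeasurable
  have p2 : IsProbabilityMeasure (Q.map (X 0)) :=
    Measure.isProbabilityMeasure_map (measurable_X 0).aemeasurable
  have i1 : IsProbabilityMeasure (tilt μ δ) := h1 ▸ p1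
  have i2 : IsProbabilityMeasure (tilt ν γ) := h2 ▸ p2
  have hcoe : Measurable ((↑) : PosReal → ℝ) := measurable_subtype_coe
  have hQeq : Q = canonical (tilt μ δ) (tilt ν γ) :=
    hQ.memMS1.crp.eq_canonical.trans (canonical_congr h1 h2)
  have hmX : ∫⁻ x : PosReal, ENNReal.ofReal x ∂(tilt ν γ) < ∞ := by
    have h := hQ.memMS1.mean_X
    rw [hQeq] at h
    exact (expect_X (tilt μ δ) (tilt ν γ) hcoe 0).symm.trans_lt h
  have hmW : ∫⁻ w : PosReal, ENNReal.ofReal w ∂(tilt μ δ) < ∞ := by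
    have h := hQ.memMS1.mean_W
    rw [hQeq] at h
    exact (expect_W (tilt μ δ) (tilt ν γ) hcoe 0).symm.trans_lt h
  have hne := ae_nonExploded (tilt μ δ) (tilt ν γ) hmW
  refine ⟨γ, δ, memCP_iff.2 ⟨hγ, hδ, i2, i1, hmX, hmW, ?_⟩, hQeq⟩
  refine drift_of_ae_ruin c hmW hmX hc.le v ?_
  have hruin := hQ.ruin
  rw [hQeq] at hruin
  have hae : ∀ᵐ ω ∂(canonical (tilt μ δ) (tilt ν γ)), ∃ n : ℕ, ω ∈ ruinAt c v n := by
    -- The ruin event is defined through uncountably many times; it is replaced by an almost surely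
    -- equal countable union, whose measurability allows passing to the complement.
    have hmeas : MeasurableSet (⋃ n, ruinAt c v n) :=
      MeasurableSet.iUnion (measurableSet_ruinAt c v)
    have h1' : canonical (tilt μ δ) (tilt ν γ) (⋃ n, ruinAt c v n) = 1 := by
      rw [← hruin]
      refine measure_congr ?_
      filter_upwards [hne] with ω hω
      refine propext ?_
      change (ω ∈ ⋃ n, ruinAt c v n) ↔ ruinTime c v ω < ∞
      rw [ruinTime_lt_top_iff, exists_surplus_neg_iff hc.le v hω, Set.mem_iUnion,
        exists_mem_ruinAt_iff]
    have := (prob_compl_eq_zero_iff hmeas).2 h1'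
    have h2' : ∀ᵐ ω ∂(canonical (tilt μ δ) (tilt ν γ)), ω ∈ ⋃ n, ruinAt c v n := this
    filter_upwards [h2'] with ω hω
    exact Set.mem_iUnion.1 hω
  filter_upwards [hae] with ω hω
  exact (exists_mem_ruinAt_iff c v ω).1 hω

end Classes

end

end SparreAndersen

/-! ### The correspondence between ruin-inducing measures and admissible pairs -/

theorem theorem3p1
    (μ ν : Measure PosReal) [IsProbabilityMeasure μ] [IsProbabilityMeasure ν]
    (P : Measure Ω) (hP : P = canonical μ ν)
    (c : ℝ) (hc : 0 < c)
    (hX : expect P (fun ω => X 0 ω) < ∞) (hW : expect P (fun ω => W 0 ω) < ∞)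
    (hNPC : expect P (fun ω => X 0 ω) < ENNReal.ofReal c * expect P (fun ω => W 0 ω))
    (v : ℝ≥0) :
    -- every ruin-inducing measure comes from an essentially unique admissible pair
    (∀ Q : Measure Ω, RuinInducing P c v Q →
      ∃ γ δ : PosReal → ℝ, MemCP P c γ δ ∧ DensityH P Q γ δ ∧ DensityF P Q γ δ ∧
        RuinRepresentation P c Q γ δ ∧
        ∀ γ' δ' : PosReal → ℝ, MemCP P c γ' δ' → DensityH P Q γ' δ' → DensityF P Q γ' δ' →
          EssEq P γ δ γ' δ') ∧
    -- every admissible pair determines a unique probability measure, which is ruin-inducing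
    (∀ γ δ : PosReal → ℝ, MemCP P c γ δ →
      ∃ Q : Measure Ω, RuinInducing P c v Q ∧ DeterminedBy P Q γ δ ∧ DensityF P Q γ δ ∧
        RuinRepresentation P c Q γ δ ∧
        ∀ Q' : Measure Ω, IsProbabilityMeasure Q' → DeterminedBy P Q' γ δ → Q' = Q) ∧
    -- the correspondence is one-to-one, pairs being identified when essentially equal
    (∃ e : {Q : Measure Ω // RuinInducing P c v Q} ≃ Quotient (pairSetoid P c),
      ∀ Q p, e Q = Quotient.mk (pairSetoid P c) p ↔ DeterminedBy P Q.1 p.1.1 p.1.2) := by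
  subst hP
  have hcoe : Measurable ((↑) : PosReal → ℝ) := measurable_subtype_coe
  rw [expect_W μ ν hcoe 0] at hW
  rw [expect_X μ ν hcoe 0, expect_W μ ν hcoe 0] at hNPC
  have spec := fun γ δ (h : MemCP (canonical μ ν) c γ δ) => canonicalTilt_spec hc hW hNPC h v
  have hne := ae_nonExploded μ ν hW
  -- Uniqueness of the measure comes from the filtration generating the whole σ-algebra.
  have huniq : ∀ γ δ (_ : MemCP (canonical μ ν) c γ δ) (Q : Measure Ω),
      DeterminedBy (canonical μ ν) Q γ δ → Q = canonicalTilt μ ν γ δ := by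
    intro γ δ h Q hQ
    obtain ⟨hR, hD, -⟩ := spec γ δ h
    have := hR.memMS1.isProb
    exact (hD.unique hQ).symm
  refine ⟨?_, ?_, ?_⟩
  · intro Q hQ
    have hprob := hQ.memMS1.isProb
    obtain ⟨γ, δ, hmem, rfl⟩ := hQ.exists_pair hc
    obtain ⟨-, hD, hF, hrep⟩ := spec γ δ hmem
    refine ⟨γ, δ, hmem, densityH_of_determinedBy hmem.meas_γ hmem.meas_δ hne hD, hF, hrep, ?_⟩
    intro γ' δ' hmem' hH' _
    -- Equivalence on each `filtH t` turns the density of the second pair into set-function form.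
    -- Both pairs then tilt to the same measure, whose marginals recover them up to null sets.
    have hD' := determinedBy_of_densityH
      (fun t A hA h0 => (hQ.memMS1.progEquiv t A hA).2 h0) hH'
    exact (canonicalTilt_eq_iff hmem hmem').1 (huniq γ' δ' hmem' _ hD')
  · intro γ δ hmem
    obtain ⟨hR, hD, hF, hrep⟩ := spec γ δ hmem
    exact ⟨_, hR, hD, hF, hrep, fun Q' _ hQ' => huniq γ δ hmem Q' hQ'⟩
  -- The bijection is built from pairs to measures, where tilting is explicit, and then inverted.
  · let g : Quotient (pairSetoid (canonical μ ν) c) →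
        {Q : Measure Ω // RuinInducing (canonical μ ν) c v Q} :=
      Quotient.lift (fun p => ⟨canonicalTilt μ ν p.1.1 p.1.2, (spec _ _ p.2).1⟩)
        fun p q hpq => Subtype.ext ((canonicalTilt_eq_iff p.2 q.2).2 hpq)
    have hg : Function.Bijective g := by
      constructor
      · intro a b
        induction a using Quotient.inductionOn with | _ p
        induction b using Quotient.inductionOn with | _ q
        intro h
        exact Quotient.sound ((canonicalTilt_eq_iff p.2 q.2).1 (congrArg Subtype.val h))
      · rintro ⟨Q, hQ⟩
        obtain ⟨γ, δ, hmem, rfl⟩ := hQ.exists_pair hc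
        exact ⟨Quotient.mk _ ⟨(γ, δ), hmem⟩, rfl⟩
    refine ⟨(Equiv.ofBijective g hg).symm, fun Q p => ?_⟩
    rw [Equiv.symm_apply_eq]
    constructor
    · intro h
      have : Q.1 = canonicalTilt μ ν p.1.1 p.1.2 := congrArg Subtype.val h
      rw [this]
      exact (spec _ _ p.2).2.1
    · intro h
      exact Subtype.ext (huniq _ _ p.2 _ h)
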